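/- Let $p\in\{1,2,3\}$. Work in the real space $L^2=L^2(0,2\pi)$ with norm $\|\cdot\|$, and let $A^{(p)}:L^2\to L^2$, $(A^{(p)}\varphi)(x)=\frac{1}{\Gamma(p)}\int_0^x(x-t)^{p-1}\varphi(t)\,dt$. For $n\in\mathbb N$ let $P_n$ be the orthogonal projection of $L^2$ onto $X_n=\mathrm{span}\{\frac1{\sqrt{2\pi}},\frac{\cos kt}{\sqrt\pi},\frac{\sin kt}{\sqrt\pi}:1\le k\le n\}$, let $A_n^{(p)}=P_nA^{(p)}P_n:X_n\to X_n$, and let $A_n^{(p)\dagger}$ be its Moore–Penrose inverse ($A_n^{(p)\dagger}z$ is the element of smallest norm among the minimisers $x\in X_n$ of $\|A_n^{(p)}x-z\|$). Let $H^p(0,2\pi)$ be the space of $y\in L^2$ whose weak derivatives of orders $1,\dots,p$ lie in $L^2$, and $\mathcal H_0^p(0,2\pi)=\{y\in H^p(0,2\pi): y(0)=\dots=y^{(p-1)}(0)=0\}$, where the point values are those of the representative of $y$ in $C^{p-1}[0,2\pi]$; $y^{(p)}$ denotes the weak derivative. For $s>0$ let $H^s_{per}(0,2\pi)$ be the space of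 $\varphi\in L^2$ with $$\|\varphi\|_{H^s_{per}}^2=\xi_0^2+\sum_{k=1}^\infty(1+k^2)^s(\xi_k^2+\eta_k^2)<\infty,$$ where $\xi_0=\frac1{\sqrt{2\pi}}\int_0^{2\pi}\varphi$, $\xi_k=\frac1{\sqrt\pi}\int_0^{2\pi}\varphi(t)\cos kt\,dt$, $\eta_k=\frac1{\sqrt\pi}\int_0^{2\pi}\varphi(t)\sin kt\,dt$. Put $C^{(1)}=\sqrt3$, $C^{(2)}=11.8040$, $C^{(3)}=345.0754$ and $\gamma^{(p)}=1+\kappa^{(p)}$, where $$\kappa^{(1)}=\Big(\tfrac{2}{\pi^2}+\tfrac{4}{\pi^2}\Big)^{1/2},\qquad \kappa^{(2)}=\Big(2+4+\pi^2+\tfrac92+9+25\Big)^{1/2},$$ $$\kappa^{(3)}=\Big((11\sqrt2)^2+23^2+(11\pi)^2+\big(\tfrac{44\sqrt2}{3}\big)^2+30^2+48^2\Big)^{1/2}.$$ **Theorem 6.1.** Let $y\in\mathcal H_0^p(0,2\pi)$ and let $y^\delta\in L^2$ satisfy $\|y^\delta-y\|\le\delta$. 1. For every integer $n\ge1$, $$\|A_n^{(p)\dagger}P_ny^\delta-y^{(p)}\|\le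 C^{(p)}n^p\delta+(\gamma^{(p)}+1)\|(I-P_n)y^{(p)}\|.$$ 2. If $y^{(p)}\in H^l_{per}(0,2\pi)$ for some real $l>0$, then for every integer $n\ge1$, $$\|A_n^{(p)\dagger}P_ny^\delta-y^{(p)}\|\le C^{(p)}n^p\delta+(\gamma^{(p)}+1)\frac1{n^l}\|y^{(p)}\|_{H^l_{per}}.$$ 3. For all real $\mu>0$ (in particular $\mu=\frac12$ and $\mu=1$) and $c>0$ there is a constant $K$, depending only on $p,\mu,c$, such that, if $y^{(p)}\in H^{2\mu p}_{per}(0,2\pi)$ and $0<\delta\le1$, then with $n(\delta)=\big\lceil c\,\delta^{-\frac1{(2\mu+1)p}}\big\rceil$, $$\|A_{n(\delta)}^{(p)\dagger}P_{n(\delta)}y^\delta-y^{(p)}\|\le K\big(1+\|y^{(p)}\|_{H^{2\mu p}_{per}}\big)\,\delta^{\frac{2\mu}{2\mu+1}},$$ that is, the rate $O(\delta^{\frac{2\mu}{2\mu+1}})$ as $\delta\to0^+$. -/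

import Mathlib

open MeasureTheory Set
open scoped ContDiff

namespace NumDiff

noncomputable section

/-- Lebesgue measure on the interval `(0, 2π)`. -/
abbrev mu : Measure ℝ := volume.restrict (Ioo 0 (2 * Real.pi))

/-- The real Hilbert space `L²(0, 2π)`. -/
abbrev L2 : Type := Lp ℝ 2 mu

/-! ### Moore-Penrose inverse -/

section MoorePenrose

variable {X Y : Type*} [NormedAddCommGroup X] [InnerProductSpace ℝ X]
  [NormedAddCommGroup Y] [InnerProductSpace ℝ Y]

/-- `x` minimises the residual `‖A x - y‖` over the whole space. -/
def IsLeastSquares (A : X →ₗ[ℝ] Y) (y : Y) (x : X) : Prop :=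
  ∀ z : X, ‖A x - y‖ ≤ ‖A z - y‖

/-- `x` is an element of smallest norm among the minimisers of the residual `‖A x - y‖`. -/
def IsMinNormLeastSquares (A : X →ₗ[ℝ] Y) (y : Y) (x : X) : Prop :=
  IsLeastSquares A y x ∧ ∀ z : X, IsLeastSquares A y z → ‖x‖ ≤ ‖z‖

/-- The Moore-Penrose inverse: `A† y` is the element of smallest norm among the minimisers of
`‖A x - y‖` (and `0` where there is none, that is, outside the domain of `A†`; when `X` is
finite-dimensional the element always exists and is unique, see below). -/
def moorePenroseInv (A : X →ₗ[ℝ] Y) (y : Y) : X :=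
  open Classical in
  if h : ∃ x, IsMinNormLeastSquares A y x then h.choose else 0

theorem existsUnique_isMinNormLeastSquares [FiniteDimensional ℝ X] (A : X →ₗ[ℝ] Y) (y : Y) :
    ∃! x, IsMinNormLeastSquares A y x := by
  obtain ⟨x0, hx0⟩ : ∃ x0, A x0 = (LinearMap.range A).starProjection y :=
    LinearMap.mem_range.1 ((LinearMap.range A).starProjection_apply_mem y)
  have pyth : ∀ z, ‖A z - y‖ ^ 2 = ‖A z - A x0‖ ^ 2 + ‖A x0 - y‖ ^ 2 := by
    intro z
    have h1 : inner ℝ (A z - A x0) (A x0 - y) = 0 := by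
      have hy : y - (LinearMap.range A).starProjection y ∈ (LinearMap.range A)ᗮ :=
        Submodule.sub_starProjection_mem_orthogonal y
      have := (Submodule.mem_orthogonal _ _).1 hy (A (z - x0)) ⟨_, rfl⟩
      rw [← hx0, map_sub] at this
      rw [← neg_sub y (A x0), inner_neg_right, this, neg_zero]
    have h2 : A z - y = (A z - A x0) + (A x0 - y) := by abel
    rw [h2, @norm_add_sq_real, h1]
    ring
  have lsq : ∀ x, IsLeastSquares A y x ↔ A x = A x0 := by
    intro x
    constructor
    · intro h
      have h1 := h x0
      have h2 := pyth x
      have h3 : ‖A x - A x0‖ ^ 2 ≤ 0 := by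
        nlinarith [norm_nonneg (A x - y), norm_nonneg (A x0 - y)]
      have h4 : ‖A x - A x0‖ = 0 := by
        nlinarith [norm_nonneg (A x - A x0)]
      exact sub_eq_zero.1 (norm_eq_zero.1 h4)
    · intro h z
      rw [h]
      have h2 := pyth z
      nlinarith [norm_nonneg (A z - y), norm_nonneg (A x0 - y), sq_nonneg ‖A z - A x0‖]
  set k := x0 - (LinearMap.ker A).starProjection x0 with hk
  have hAk : A k = A x0 := by
    have : A ((LinearMap.ker A).starProjection x0) = 0 :=
      (LinearMap.ker A).starProjection_apply_mem x0
    rw [hk, map_sub, this, sub_zero]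
  have hko : k ∈ (LinearMap.ker A)ᗮ := Submodule.sub_starProjection_mem_orthogonal x0
  have pyth2 : ∀ z, A z = A x0 → ‖z‖ ^ 2 = ‖z - k‖ ^ 2 + ‖k‖ ^ 2 := by
    intro z hz
    have h1 : inner ℝ (z - k) k = 0 := by
      refine (Submodule.mem_orthogonal _ _).1 hko (z - k) ?_
      rw [LinearMap.mem_ker, map_sub, hz, hAk, sub_self]
    have h2 : z = (z - k) + k := by abel
    conv_lhs => rw [h2]
    rw [@norm_add_sq_real, h1]
    ring
  refine ⟨k, ⟨(lsq k).2 hAk, fun z hz => ?_⟩, fun z hz => ?_⟩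
  · have := pyth2 z ((lsq z).1 hz)
    nlinarith [norm_nonneg z, norm_nonneg k, sq_nonneg ‖z - k‖]
  · have h1 := pyth2 z ((lsq z).1 hz.1)
    have h2 := hz.2 k ((lsq k).2 hAk)
    have h4 : ‖z - k‖ = 0 := by
      nlinarith [norm_nonneg z, norm_nonneg k, norm_nonneg (z - k)]
    exact sub_eq_zero.1 (norm_eq_zero.1 h4)

/-- On a finite-dimensional space `A† y` is the minimal-norm least-squares solution. -/
theorem moorePenroseInv_spec [FiniteDimensional ℝ X] (A : X →ₗ[ℝ] Y) (y : Y) :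
    IsMinNormLeastSquares A y (moorePenroseInv A y) := by
  have h := (existsUnique_isMinNormLeastSquares A y).exists
  unfold moorePenroseInv
  rw [dif_pos h]
  exact h.choose_spec

end MoorePenrose

/-! ### The integro-differential operator -/

/-- The function `x ↦ (1 / Γ(p)) ∫₀ˣ (x - t)^(p-1) φ(t) dt`. -/
def volterraFun (p : ℕ) (φ : ℝ → ℝ) (x : ℝ) : ℝ :=
  1 / Real.Gamma p * ∫ t in (0 : ℝ)..x, (x - t) ^ (p - 1) * φ t

theorem integrable_coe (φ : L2) : Integrable φ mu :=
  (Lp.memLp φ).integrable (by norm_num)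

theorem intervalIntegrable_kernel (p : ℕ) {f : ℝ → ℝ} (hf : Integrable f mu) {x : ℝ}
    (hx : x ∈ Ioo 0 (2 * Real.pi)) :
    IntervalIntegrable (fun t => (x - t) ^ (p - 1) * f t) volume 0 x := by
  have h1 : IntervalIntegrable f volume 0 x := by
    rw [intervalIntegrable_iff_integrableOn_Ioc_of_le hx.1.le]
    exact IntegrableOn.mono_set hf fun t ht => ⟨ht.1, ht.2.trans_lt hx.2⟩
  exact h1.continuousOn_mul (by fun_prop)

theorem memLp_volterraFun (p : ℕ) (φ : L2) : MemLp (volterraFun p φ) 2 mu := by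
  have hmeas : AEStronglyMeasurable (volterraFun p φ) mu := by
    have hs : MeasurableSet {q : ℝ × ℝ | 0 < q.2 ∧ q.2 ≤ q.1} :=
      (measurableSet_lt measurable_const measurable_snd).inter
        (measurableSet_le measurable_snd measurable_fst)
    have hF : StronglyMeasurable
        ({q : ℝ × ℝ | 0 < q.2 ∧ q.2 ≤ q.1}.indicator
          fun q : ℝ × ℝ => (q.1 - q.2) ^ (p - 1) * φ q.2) := by
      refine StronglyMeasurable.indicator ?_ hs
      have h1 : Measurable (φ : ℝ → ℝ) := (Lp.stronglyMeasurable φ).measurable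
      exact Measurable.stronglyMeasurable (by fun_prop)
    have hI : StronglyMeasurable fun x : ℝ => ∫ t,
        ({q : ℝ × ℝ | 0 < q.2 ∧ q.2 ≤ q.1}.indicator
          fun q : ℝ × ℝ => (q.1 - q.2) ^ (p - 1) * φ q.2) (x, t) :=
      StronglyMeasurable.integral_prod_right hF
    refine ((hI.const_mul (1 / Real.Gamma p)).aestronglyMeasurable).congr ?_
    filter_upwards [ae_restrict_mem measurableSet_Ioo] with x hx
    unfold volterraFun
    rw [intervalIntegral.integral_of_le hx.1.le, ← integral_indicator measurableSet_Ioc]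
    rfl
  refine MemLp.of_bound hmeas
    (|1 / Real.Gamma p| * ((2 * Real.pi) ^ (p - 1) * ∫ t, ‖φ t‖ ∂mu)) ?_
  filter_upwards [ae_restrict_mem measurableSet_Ioo] with x hx
  unfold volterraFun
  rw [norm_mul, Real.norm_eq_abs]
  refine mul_le_mul_of_nonneg_left ?_ (abs_nonneg _)
  have hn : Integrable (fun t => ‖φ t‖) mu := (integrable_coe φ).norm
  have hsub : Ioc 0 x ⊆ Ioo 0 (2 * Real.pi) := fun t ht => ⟨ht.1, ht.2.trans_lt hx.2⟩
  calc ‖∫ t in (0 : ℝ)..x, (x - t) ^ (p - 1) * φ t‖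
      ≤ ∫ t in (0 : ℝ)..x, ‖(x - t) ^ (p - 1) * φ t‖ :=
        intervalIntegral.norm_integral_le_integral_norm hx.1.le
    _ = ∫ t in Ioc 0 x, ‖(x - t) ^ (p - 1) * φ t‖ :=
        intervalIntegral.integral_of_le hx.1.le
    _ ≤ ∫ t in Ioc 0 x, (2 * Real.pi) ^ (p - 1) * ‖φ t‖ := by
        refine setIntegral_mono_on ?_ ?_ measurableSet_Ioc ?_
        · exact ((intervalIntegrable_iff_integrableOn_Ioc_of_le hx.1.le).1
            (intervalIntegrable_kernel p (integrable_coe φ) hx)).norm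
        · exact (IntegrableOn.mono_set hn hsub).const_mul _
        · intro t ht
          rw [norm_mul, norm_pow]
          refine mul_le_mul_of_nonneg_right ?_ (norm_nonneg _)
          refine pow_le_pow_left₀ (norm_nonneg _) ?_ _
          rw [Real.norm_eq_abs, abs_of_nonneg (by linarith [ht.2])]
          linarith [ht.1, hx.2]
    _ = (2 * Real.pi) ^ (p - 1) * ∫ t in Ioc 0 x, ‖φ t‖ := integral_const_mul _ _
    _ ≤ (2 * Real.pi) ^ (p - 1) * ∫ t, ‖φ t‖ ∂mu := by
        refine mul_le_mul_of_nonneg_left ?_ (by positivity)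
        exact setIntegral_mono_set hn (Filter.Eventually.of_forall fun t => norm_nonneg _)
          hsub.eventuallyLE

/-- The operator `A^(p) : L²(0,2π) → L²(0,2π)`,
`(A^(p) φ)(x) = (1 / Γ(p)) ∫₀ˣ (x - t)^(p-1) φ(t) dt`. -/
def opA (p : ℕ) : L2 →ₗ[ℝ] L2 where
  toFun φ := (memLp_volterraFun p φ).toLp (volterraFun p φ)
  map_add' φ ψ := by
    rw [← MemLp.toLp_add]
    refine MemLp.toLp_congr (memLp_volterraFun p _) _ ?_
    filter_upwards [ae_restrict_mem measurableSet_Ioo] with x hx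
    have hae := (ae_restrict_iff' measurableSet_Ioo).1 (Lp.coeFn_add φ ψ)
    simp only [volterraFun, Pi.add_apply]
    rw [← mul_add, ← intervalIntegral.integral_add
      (intervalIntegrable_kernel p (integrable_coe φ) hx)
      (intervalIntegrable_kernel p (integrable_coe ψ) hx)]
    congr 1
    refine intervalIntegral.integral_congr_ae ?_
    filter_upwards [hae] with t ht hmem
    rw [uIoc_of_le hx.1.le] at hmem
    rw [ht ⟨hmem.1, hmem.2.trans_lt hx.2⟩, Pi.add_apply]
    ring
  map_smul' c φ := by
    rw [RingHom.id_apply, ← MemLp.toLp_const_smul c (memLp_volterraFun p φ)]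
    refine MemLp.toLp_congr (memLp_volterraFun p _) _ ?_
    filter_upwards [ae_restrict_mem measurableSet_Ioo] with x hx
    have hae := (ae_restrict_iff' measurableSet_Ioo).1 (Lp.coeFn_smul c φ)
    simp only [volterraFun, Pi.smul_apply, smul_eq_mul]
    rw [mul_left_comm c (1 / Real.Gamma p), ← intervalIntegral.integral_const_mul c]
    congr 1
    refine intervalIntegral.integral_congr_ae ?_
    filter_upwards [hae] with t ht hmem
    rw [uIoc_of_le hx.1.le] at hmem
    rw [ht ⟨hmem.1, hmem.2.trans_lt hx.2⟩, Pi.smul_apply, smul_eq_mul]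
    ring

/-! ### Trigonometric subspaces and the Galerkin operators -/

/-- The function `t ↦ cos (k t)` (for `k = 0` the constant `1`) as an element of `L²(0,2π)`. -/
def cosL2 (k : ℕ) : L2 :=
  (MemLp.of_bound (C := 1) (f := fun t : ℝ => Real.cos (k * t)) (p := 2) (μ := mu)
    (by fun_prop) (Filter.Eventually.of_forall fun t => Real.abs_cos_le_one _)).toLp _

/-- The function `t ↦ sin (k t)` as an element of `L²(0,2π)`. -/
def sinL2 (k : ℕ) : L2 :=
  (MemLp.of_bound (C := 1) (f := fun t : ℝ => Real.sin (k * t)) (p := 2) (μ := mu)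
    (by fun_prop) (Filter.Eventually.of_forall fun t => Real.abs_sin_le_one _)).toLp _

/-- `X_n`, the span of `1/√(2π)` and `cos(kt)/√π`, `sin(kt)/√π` for `1 ≤ k ≤ n`. -/
def trigSpace (n : ℕ) : Submodule ℝ L2 :=
  Submodule.span ℝ
    ({(1 / Real.sqrt (2 * Real.pi)) • cosL2 0} ∪
      (fun k => (1 / Real.sqrt Real.pi) • cosL2 k) '' Icc 1 n ∪
      (fun k => (1 / Real.sqrt Real.pi) • sinL2 k) '' Icc 1 n)

instance finiteDimensional_trigSpace (n : ℕ) : FiniteDimensional ℝ (trigSpace n) :=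
  FiniteDimensional.span_of_finite ℝ
    (((finite_singleton _).union ((finite_Icc 1 n).image _)).union ((finite_Icc 1 n).image _))

/-- The orthogonal projection `P_n` of `L²(0,2π)` onto `X_n`. -/
def projX (n : ℕ) : L2 →ₗ[ℝ] trigSpace n :=
  ((trigSpace n).orthogonalProjectionOnto : L2 →L[ℝ] trigSpace n)

/-- The Galerkin operator `A_n^(p) = P_n A^(p) P_n : X_n → X_n`. -/
def galerkinOp (p n : ℕ) : trigSpace n →ₗ[ℝ] trigSpace n :=
  projX n ∘ₗ opA p ∘ₗ (trigSpace n).subtype ∘ₗ projX n ∘ₗ (trigSpace n).subtype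

/-- The regularized scheme `A_n^(p)† P_n f`, as an element of `L²(0,2π)`. -/
def scheme (p n : ℕ) (f : L2) : L2 :=
  (moorePenroseInv (galerkinOp p n) (projX n f) : trigSpace n)

/-! ### Sobolev spaces on the interval -/

/-- `ζ ∈ L²(0,2π)` is the weak derivative `D^k y` of order `k` of `y ∈ L²(0,2π)`:
`∫ ζ φ = (-1)^k ∫ y φ^(k)` for every `φ ∈ C_0^∞(0,2π)`. -/
def HasWeakDeriv (k : ℕ) (y ζ : L2) : Prop :=
  ∀ φ : ℝ → ℝ, ContDiff ℝ ∞ φ → HasCompactSupport φ → tsupport φ ⊆ Ioo 0 (2 * Real.pi) →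
    ∫ x in Ioo 0 (2 * Real.pi), ζ x * φ x =
      (-1) ^ k * ∫ x in Ioo 0 (2 * Real.pi), y x * iteratedDeriv k φ x

/-- The weak derivative `y^(k)` (the zero function if there is none). -/
def weakDeriv (k : ℕ) (y : L2) : L2 :=
  open Classical in
  if h : ∃ ζ, HasWeakDeriv k y ζ then h.choose else 0

/-- The Sobolev space `H^p(0,2π)`. -/
def sobolevH (p : ℕ) : Set L2 :=
  {y | ∀ k, 1 ≤ k → k ≤ p → ∃ ζ, HasWeakDeriv k y ζ}

/-- `H_0^p(0,2π)`, the functions of `H^p(0,2π)` with `y(0) = ⋯ = y^(p-1)(0) = 0`. The point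
values are those of the representative of `y` in `C^(p-1)[0,2π]` (for `p ≥ 1`). -/
def sobolevH0 (p : ℕ) : Set L2 :=
  {y | y ∈ sobolevH p ∧ ∃ Y : ℝ → ℝ, ContDiffOn ℝ ((p - 1 : ℕ) : ℕ∞) Y (Icc 0 (2 * Real.pi)) ∧
    y =ᵐ[mu] Y ∧ ∀ k < p, iteratedDerivWithin k Y (Icc 0 (2 * Real.pi)) 0 = 0}

/-! ### Periodic Sobolev spaces -/

/-- The Fourier coefficient `ξ_0 = (1/√(2π)) ∫ f`. -/
def fourierZero (f : L2) : ℝ :=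
  1 / Real.sqrt (2 * Real.pi) * ∫ t in Ioo 0 (2 * Real.pi), f t

/-- The Fourier coefficient `ξ_k = (1/√π) ∫ f(t) cos(kt) dt`. -/
def fourierCos (f : L2) (k : ℕ) : ℝ :=
  1 / Real.sqrt Real.pi * ∫ t in Ioo 0 (2 * Real.pi), f t * Real.cos (k * t)

/-- The Fourier coefficient `η_k = (1/√π) ∫ f(t) sin(kt) dt`. -/
def fourierSin (f : L2) (k : ℕ) : ℝ :=
  1 / Real.sqrt Real.pi * ∫ t in Ioo 0 (2 * Real.pi), f t * Real.sin (k * t)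

/-- The weighted term `(1 + k²)^s (ξ_k² + η_k²)`. -/
def perTerm (s : ℝ) (f : L2) (k : ℕ) : ℝ :=
  (1 + (k : ℝ) ^ 2) ^ s * (fourierCos f k ^ 2 + fourierSin f k ^ 2)

/-- The periodic Sobolev space `H^s_per(0,2π)`; the sum runs over `k ≥ 1`. -/
def perSobolev (s : ℝ) : Set L2 :=
  {f | Summable fun k : ℕ => perTerm s f (k + 1)}

/-- The norm of `H^s_per(0,2π)`. -/
def perNorm (s : ℝ) (f : L2) : ℝ :=
  Real.sqrt (fourierZero f ^ 2 + ∑' k : ℕ, perTerm s f (k + 1))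

/-! ### The constants -/

/-- `C^(1) = √3`, `C^(2) = 11.8040`, `C^(3) = 345.0754`. -/
def constC : ℕ → ℝ
  | 1 => Real.sqrt 3
  | 2 => 11.8040
  | 3 => 345.0754
  | _ => 0

/-- `κ^(p) = (∑ᵢ (C_i^(p))²)^(1/2)` with the six constants `C_1^(p), …, C_6^(p)`. -/
def constKappa : ℕ → ℝ
  | 1 => Real.sqrt (0 ^ 2 + 0 ^ 2 + 0 ^ 2 +
      (Real.sqrt 2 / Real.pi) ^ 2 + (2 / Real.pi) ^ 2 + 0 ^ 2)
  | 2 => Real.sqrt (Real.sqrt 2 ^ 2 + 2 ^ 2 + Real.pi ^ 2 +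
      (3 * Real.sqrt 2 / 2) ^ 2 + 3 ^ 2 + 5 ^ 2)
  | 3 => Real.sqrt ((11 * Real.sqrt 2) ^ 2 + 23 ^ 2 + (11 * Real.pi) ^ 2 +
      (44 * Real.sqrt 2 / 3) ^ 2 + 30 ^ 2 + 48 ^ 2)
  | _ => 0

/-- `γ^(p) = 1 + κ^(p)`. -/
def constGamma (p : ℕ) : ℝ := 1 + constKappa p

end

end NumDiff

open MeasureTheory Set
open scoped ContDiff

namespace NumDiff

noncomputable section

/-! ### The Volterra operator as iterated integration -/

/-! Write A for `opA 1`, u for the p-th weak derivative of y, and a for the output of the scheme.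
Everything rests on one stability estimate (`norm_proj_le_of_opA`), valid for every v in L², not
only for v in X_n: ‖P_n v‖ ≤ C n^p ‖P_n A^(p) v‖ + γ ‖v - P_n v‖. For v in X_n it makes the Galerkin
operator injective, hence bijective, so the Moore-Penrose inverse is an honest inverse. For v = a -
u it gives the error bound: A^(p) u = y (`opA_weakDeriv`, by du Bois-Reymond), so P_n A^(p) v =
P_n(yδ - y), while v - P_n v = -(u - P_n u). Parseval bounds this tail under periodic smoothness,
and the choice of n balances the two terms.

For the stability estimate, integration by parts expresses the Fourier coefficients of Av through
those of v. Up to frequency n, v is the derivative of Av, except that the mean x of v enters every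
cosine coefficient; thus P_n v is the derivative of P_n Av plus a multiple x of the Dirichlet kernel
D_n (`proj_eq_trigDeriv_add`). Only the mean is missing. It is recovered by pairing Av with D_n: the
adjoint of A maps D_n to π + R_n, with R_n the tail (I - P_n)(π - t) of the sawtooth, so this
pairing is πx plus a term seeing only (I - P_n)v. The product ‖D_n‖ ‖R_n‖ is at most 4π, uniformly
in n.

For p = 2, 3 the means of v, Av (and A²v) are all unknown. Pairing A^(p) v with D_n and its
derivatives gives one equation per mean. After weighting by powers of n the system is tridiagonal,
with diagonal π and off-diagonal entries s, t satisfying s ≤ 2, t ≤ 3, st ≤ 4. Since 2st < π², it is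
invertible uniformly in n. The resulting constants 7, 4 and 40, 26 lie below the stated ones; only p
= 1, with √3, needs a sharper argument. -/

theorem two_pi_nonneg : (0 : ℝ) ≤ 2 * Real.pi := by positivity

theorem intervalIntegrable_coe (φ : L2) : IntervalIntegrable φ volume 0 (2 * Real.pi) :=
  (intervalIntegrable_iff_integrableOn_Ioo_of_le two_pi_nonneg).2 (integrable_coe φ)

theorem intervalIntegrable_coe_of_mem (φ : L2) {x : ℝ} (hx : x ∈ Icc 0 (2 * Real.pi)) :
    IntervalIntegrable φ volume 0 x :=
  (intervalIntegrable_coe φ).mono_set (by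
    rw [uIcc_of_le hx.1, uIcc_of_le two_pi_nonneg]; exact Icc_subset_Icc_right hx.2)

theorem intervalIntegrable_mul_coe (f g : L2) :
    IntervalIntegrable (fun x => f x * g x) volume 0 (2 * Real.pi) :=
  (intervalIntegrable_iff_integrableOn_Ioo_of_le two_pi_nonneg).2
    ((Lp.memLp f).integrable_mul (Lp.memLp g))

theorem integral_mu_eq (f : ℝ → ℝ) :
    ∫ x in Ioo 0 (2 * Real.pi), f x = ∫ x in (0 : ℝ)..(2 * Real.pi), f x := by
  rw [intervalIntegral.integral_of_le two_pi_nonneg, integral_Ioc_eq_integral_Ioo]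

theorem integral_congr_of_ae_mu {f g : ℝ → ℝ} (h : f =ᵐ[mu] g) {x : ℝ}
    (hx : x ∈ Icc 0 (2 * Real.pi)) : ∫ t in (0 : ℝ)..x, f t = ∫ t in (0 : ℝ)..x, g t := by
  rw [intervalIntegral.integral_of_le hx.1, intervalIntegral.integral_of_le hx.1,
    integral_Ioc_eq_integral_Ioo, integral_Ioc_eq_integral_Ioo]
  exact integral_congr_ae (ae_restrict_of_ae_restrict_of_subset (Ioo_subset_Ioo_right hx.2) h)

/-- Integration by parts for the primitives of two integrable functions. -/
theorem integral_primitive_mul {f g : ℝ → ℝ} {x : ℝ}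
    (hf : IntervalIntegrable f volume 0 x) (hg : IntervalIntegrable g volume 0 x) :
    (∫ t in (0 : ℝ)..x, (∫ s in (0 : ℝ)..t, f s) * g t) +
      ∫ t in (0 : ℝ)..x, f t * ∫ s in (0 : ℝ)..t, g s =
      (∫ t in (0 : ℝ)..x, f t) * ∫ t in (0 : ℝ)..x, g t := by
  -- The primitives are only absolutely continuous, so the product rule is used almost everywhere.
  have hF := hf.absolutelyContinuousOnInterval_intervalIntegral (c := 0) left_mem_uIcc
  have hG := hg.absolutelyContinuousOnInterval_intervalIntegral (c := 0) left_mem_uIcc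
  have h := hF.integral_deriv_mul_eq_sub hG
  simp only [intervalIntegral.integral_same, mul_zero, sub_zero] at h
  rw [← h, ← intervalIntegral.integral_add (hg.continuousOn_mul hF.continuousOn)
    (hf.mul_continuousOn hG.continuousOn)]
  refine intervalIntegral.integral_congr_ae ?_
  filter_upwards [hf.ae_hasDerivAt_integral, hg.ae_hasDerivAt_integral] with t h1 h2 ht
  have ht' := uIoc_subset_uIcc ht
  rw [(h1 ht' 0 left_mem_uIcc).deriv, (h2 ht' 0 left_mem_uIcc).deriv]
  ring

theorem coeFn_opA (p : ℕ) (φ : L2) : opA p φ =ᵐ[mu] volterraFun p φ :=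
  (memLp_volterraFun p φ).coeFn_toLp

theorem volterraFun_one (f : ℝ → ℝ) (x : ℝ) : volterraFun 1 f x = ∫ t in (0 : ℝ)..x, f t := by
  simp [volterraFun]

theorem coeFn_opA_one (φ : L2) : opA 1 φ =ᵐ[mu] fun x => ∫ t in (0 : ℝ)..x, φ t := by
  filter_upwards [coeFn_opA 1 φ] with x hx
  rw [hx, volterraFun_one]

/-- `A^(p+1) = A^(p) A^(1)`. -/
theorem opA_succ {p : ℕ} (hp : 1 ≤ p) (φ : L2) : opA (p + 1) φ = opA p (opA 1 φ) := by
  refine Lp.ext ?_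
  filter_upwards [coeFn_opA (p + 1) φ, coeFn_opA p (opA 1 φ), ae_restrict_mem measurableSet_Ioo]
    with x h1 h2 hx
  have hx' : x ∈ Icc 0 (2 * Real.pi) := Ioo_subset_Icc_self hx
  rw [h1, h2]
  have hcongr : volterraFun p (opA 1 φ) x = volterraFun p (fun x => ∫ t in (0 : ℝ)..x, φ t) x := by
    unfold volterraFun
    congr 1
    refine integral_congr_of_ae_mu ?_ hx'
    filter_upwards [coeFn_opA_one φ] with t ht
    rw [ht]
  rw [hcongr]
  unfold volterraFun
  have hf := intervalIntegrable_coe_of_mem φ hx'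
  have hF := hf.absolutelyContinuousOnInterval_intervalIntegral (c := 0) left_mem_uIcc
  have hG : AbsolutelyContinuousOnInterval (fun t : ℝ => (x - t) ^ p) 0 x := by
    apply ContDiffOn.absolutelyContinuousOnInterval
    fun_prop
  -- Both boundary terms vanish: (x - t)^p at t = x, and the primitive of φ at t = 0. The factor p
  -- that appears is absorbed by Γ(p + 1) = p Γ(p).
  have h := hG.integral_mul_deriv_eq_deriv_mul hF
  have hd : ∀ t : ℝ, deriv (fun t : ℝ => (x - t) ^ p) t = -(p * (x - t) ^ (p - 1)) := by
    intro t
    have : HasDerivAt (fun t : ℝ => (x - t) ^ p) _ t := ((hasDerivAt_id' t).const_sub x).pow p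
    rw [this.deriv]; simp
  simp only [sub_self, zero_pow (by omega : p ≠ 0), zero_mul, intervalIntegral.integral_same,
    mul_zero, hd, neg_mul, intervalIntegral.integral_neg, sub_neg_eq_add, zero_add] at h
  have h3 : ∫ t in (0 : ℝ)..x, (x - t) ^ p * φ t =
      ∫ t in (0 : ℝ)..x, (x - t) ^ p * deriv (fun x => ∫ t in (0 : ℝ)..x, φ t) t := by
    refine intervalIntegral.integral_congr_ae ?_
    filter_upwards [hf.ae_hasDerivAt_integral] with t h1 ht
    rw [(h1 (uIoc_subset_uIcc ht) 0 left_mem_uIcc).deriv]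
  rw [Nat.add_sub_cancel, h3, h]
  simp only [mul_assoc]
  rw [intervalIntegral.integral_const_mul, ← mul_assoc]
  congr 1
  have hp0 : (p : ℝ) ≠ 0 := by positivity
  rw [Nat.cast_succ, Real.Gamma_add_one hp0]
  field_simp

theorem opA_two (φ : L2) : opA 2 φ = opA 1 (opA 1 φ) := opA_succ le_rfl φ

theorem opA_three (φ : L2) : opA 3 φ = opA 1 (opA 1 (opA 1 φ)) := by
  rw [opA_succ (by norm_num : 1 ≤ 2), opA_two]

/-! ### Pairings with the trigonometric functions -/

theorem inner_L2 (f g : L2) :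
    inner ℝ f g = ∫ x in (0 : ℝ)..(2 * Real.pi), f x * g x := by
  rw [L2.inner_def, integral_mu_eq]
  simp [mul_comm]

theorem coeFn_cosL2 (k : ℕ) : cosL2 k =ᵐ[mu] fun t => Real.cos (k * t) := MemLp.coeFn_toLp _

theorem coeFn_sinL2 (k : ℕ) : sinL2 k =ᵐ[mu] fun t => Real.sin (k * t) := MemLp.coeFn_toLp _

theorem right_mem_Icc_two_pi : 2 * Real.pi ∈ Icc 0 (2 * Real.pi) := right_mem_Icc.2 two_pi_nonneg

theorem inner_cosL2 (f : L2) (k : ℕ) :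
    inner ℝ f (cosL2 k) = ∫ x in (0 : ℝ)..(2 * Real.pi), f x * Real.cos (k * x) := by
  rw [inner_L2]
  refine integral_congr_of_ae_mu ?_ right_mem_Icc_two_pi
  filter_upwards [coeFn_cosL2 k] with t ht
  rw [ht]

theorem inner_sinL2 (f : L2) (k : ℕ) :
    inner ℝ f (sinL2 k) = ∫ x in (0 : ℝ)..(2 * Real.pi), f x * Real.sin (k * x) := by
  rw [inner_L2]
  refine integral_congr_of_ae_mu ?_ right_mem_Icc_two_pi
  filter_upwards [coeFn_sinL2 k] with t ht
  rw [ht]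

theorem inner_cosL2_zero (f : L2) :
    inner ℝ f (cosL2 0) = ∫ x in (0 : ℝ)..(2 * Real.pi), f x := by
  simp [inner_cosL2]

/-- Integration is skew-adjoint up to the boundary term. -/
theorem inner_opA_one (f g : L2) :
    inner ℝ (opA 1 f) g = inner ℝ f (cosL2 0) * inner ℝ g (cosL2 0) - inner ℝ f (opA 1 g) := by
  rw [eq_sub_iff_add_eq, inner_L2, inner_L2, inner_cosL2_zero, inner_cosL2_zero,
    ← integral_primitive_mul (intervalIntegrable_coe f) (intervalIntegrable_coe g)]
  congr 1
  · refine integral_congr_of_ae_mu ?_ right_mem_Icc_two_pi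
    filter_upwards [coeFn_opA_one f] with t ht
    rw [ht]
  · refine integral_congr_of_ae_mu ?_ right_mem_Icc_two_pi
    filter_upwards [coeFn_opA_one g] with t ht
    rw [ht]

theorem opA_one_cosL2 {k : ℕ} (hk : k ≠ 0) : opA 1 (cosL2 k) = (1 / (k : ℝ)) • sinL2 k := by
  refine Lp.ext ?_
  filter_upwards [coeFn_opA_one (cosL2 k), Lp.coeFn_smul (1 / (k : ℝ)) (sinL2 k), coeFn_sinL2 k,
    ae_restrict_mem measurableSet_Ioo] with x h1 h2 h3 hx
  rw [h1, h2, Pi.smul_apply, h3,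
    integral_congr_of_ae_mu (coeFn_cosL2 k) (Ioo_subset_Icc_self hx)]
  simp [intervalIntegral.integral_comp_mul_left (fun x => Real.cos x) (Nat.cast_ne_zero.2 hk)]

theorem opA_one_sinL2 {k : ℕ} (hk : k ≠ 0) :
    opA 1 (sinL2 k) = (1 / (k : ℝ)) • (cosL2 0 - cosL2 k) := by
  refine Lp.ext ?_
  filter_upwards [coeFn_opA_one (sinL2 k), Lp.coeFn_smul (1 / (k : ℝ)) (cosL2 0 - cosL2 k),
    Lp.coeFn_sub (cosL2 0) (cosL2 k), coeFn_cosL2 0, coeFn_cosL2 k,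
    ae_restrict_mem measurableSet_Ioo] with x h1 h2 h3 h4 h5 hx
  rw [h1, h2, Pi.smul_apply, h3, Pi.sub_apply, h4, h5,
    integral_congr_of_ae_mu (coeFn_sinL2 k) (Ioo_subset_Icc_self hx)]
  simp [intervalIntegral.integral_comp_mul_left (fun x => Real.sin x) (Nat.cast_ne_zero.2 hk)]

theorem inner_cosL2_zero_self : inner ℝ (cosL2 0) (cosL2 0) = 2 * Real.pi := by
  rw [inner_cosL2_zero, integral_congr_of_ae_mu (coeFn_cosL2 0) right_mem_Icc_two_pi]
  simp

theorem inner_cosL2_one {k : ℕ} (hk : k ≠ 0) : inner ℝ (cosL2 k) (cosL2 0) = 0 := by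
  rw [inner_cosL2_zero, integral_congr_of_ae_mu (coeFn_cosL2 k) right_mem_Icc_two_pi,
    intervalIntegral.integral_comp_mul_left (fun x => Real.cos x) (Nat.cast_ne_zero.2 hk)]
  have := Real.sin_nat_mul_pi (2 * k)
  push_cast at this
  simp [show (k : ℝ) * (2 * Real.pi) = 2 * k * Real.pi by ring, this]

theorem inner_sinL2_one (k : ℕ) : inner ℝ (sinL2 k) (cosL2 0) = 0 := by
  rcases eq_or_ne k 0 with rfl | hk
  · rw [inner_cosL2_zero, integral_congr_of_ae_mu (coeFn_sinL2 0) right_mem_Icc_two_pi]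
    simp
  rw [inner_cosL2_zero, integral_congr_of_ae_mu (coeFn_sinL2 k) right_mem_Icc_two_pi,
    intervalIntegral.integral_comp_mul_left (fun x => Real.sin x) (Nat.cast_ne_zero.2 hk)]
  simp [Real.cos_nat_mul_two_pi]

theorem inner_opA_one_cosL2 (f : L2) {k : ℕ} (hk : k ≠ 0) :
    inner ℝ (opA 1 f) (cosL2 k) = -(1 / (k : ℝ)) * inner ℝ f (sinL2 k) := by
  rw [inner_opA_one, inner_cosL2_one hk, opA_one_cosL2 hk, inner_smul_right]; ring

theorem inner_opA_one_sinL2 (f : L2) {k : ℕ} (hk : k ≠ 0) :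
    inner ℝ (opA 1 f) (sinL2 k) =
      (1 / (k : ℝ)) * (inner ℝ f (cosL2 k) - inner ℝ f (cosL2 0)) := by
  rw [inner_opA_one, inner_sinL2_one, opA_one_sinL2 hk, inner_smul_right, inner_sub_right]; ring

/-! ### Orthogonality relations -/

/-- No product formula is integrated: skew-adjointness of integration gives two linear relations
between ⟨cos j, sin k⟩ and ⟨cos k, sin j⟩, with determinant j² - k² up to sign. For j = k the two
unknowns coincide and the first relation alone suffices. -/
theorem inner_cosL2_sinL2 (j k : ℕ) : inner ℝ (cosL2 j) (sinL2 k) = 0 := by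
  rcases eq_or_ne k 0 with rfl | hk
  · rw [inner_sinL2]; simp
  rcases eq_or_ne j 0 with rfl | hj
  · rw [real_inner_comm, inner_sinL2_one]
  have h1 := inner_opA_one_cosL2 (cosL2 j) hk
  have h2 := inner_opA_one_sinL2 (sinL2 j) hk
  rw [opA_one_cosL2 hj, inner_smul_left, real_inner_comm] at h1
  rw [opA_one_sinL2 hj, inner_smul_left, inner_sub_left, inner_sinL2_one,
    real_inner_comm (sinL2 k) (cosL2 0), inner_sinL2_one, real_inner_comm (cosL2 k)] at h2
  simp only [RCLike.conj_to_real] at h1 h2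
  have hj' : (0 : ℝ) < j := by positivity
  have hk' : (0 : ℝ) < k := by positivity
  field_simp at h1 h2
  rcases eq_or_ne j k with rfl | hjk
  · nlinarith
  set x : ℝ := inner ℝ (cosL2 j) (sinL2 k)
  set y : ℝ := inner ℝ (cosL2 k) (sinL2 j)
  have h3 : x * (j ^ 2 - k ^ 2) = 0 := by linear_combination (j : ℝ) * h1 + (k : ℝ) * h2
  refine (mul_eq_zero.1 h3).resolve_right fun h => hjk ?_
  have : (j : ℝ) = k := by nlinarith
  exact_mod_cast this

/-- Evaluate the pairing of the primitive of cos(jt) with sin(kt) in two ways. Exchanging j and k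
gives a second relation, which forces orthogonality when j ≠ k. -/
theorem inner_sinL2_sinL2_mul {j k : ℕ} (hj : j ≠ 0) (hk : k ≠ 0) :
    (k : ℝ) * inner ℝ (sinL2 j) (sinL2 k) = j * inner ℝ (cosL2 j) (cosL2 k) := by
  have h1 := inner_opA_one_sinL2 (cosL2 j) hk
  rw [opA_one_cosL2 hj, inner_smul_left, inner_cosL2_one hj] at h1
  simp only [RCLike.conj_to_real] at h1
  field_simp at h1
  linear_combination h1

theorem inner_trig_of_ne {j k : ℕ} (hj : j ≠ 0) (hk : k ≠ 0) (hjk : j ≠ k) :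
    inner ℝ (cosL2 j) (cosL2 k) = (0 : ℝ) ∧ inner ℝ (sinL2 j) (sinL2 k) = (0 : ℝ) := by
  have h1 := inner_sinL2_sinL2_mul hj hk
  have h2 := inner_sinL2_sinL2_mul hk hj
  rw [real_inner_comm, real_inner_comm (cosL2 j)] at h2
  have hj' : (0 : ℝ) < j := by positivity
  have hk' : (0 : ℝ) < k := by positivity
  have h4 : (j : ℝ) ^ 2 - k ^ 2 ≠ 0 := by
    intro h
    apply hjk
    have : (j : ℝ) = k := by nlinarith
    exact_mod_cast this
  constructor
  · have : ((j : ℝ) ^ 2 - k ^ 2) * inner ℝ (cosL2 j) (cosL2 k) = 0 := by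
      linear_combination (k : ℝ) * h2 - (j : ℝ) * h1
    exact (mul_eq_zero.1 this).resolve_left h4
  · have : ((j : ℝ) ^ 2 - k ^ 2) * inner ℝ (sinL2 j) (sinL2 k) = 0 := by
      linear_combination (j : ℝ) * h2 - (k : ℝ) * h1
    exact (mul_eq_zero.1 this).resolve_left h4

/-- The two squared norms agree by the previous relation with j = k, and they add up to 2π because
cos² + sin² = 1. -/
theorem inner_trig_self {k : ℕ} (hk : k ≠ 0) :
    inner ℝ (cosL2 k) (cosL2 k) = Real.pi ∧ inner ℝ (sinL2 k) (sinL2 k) = Real.pi := by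
  have h1 := inner_sinL2_sinL2_mul hk hk
  have hk' : (k : ℝ) ≠ 0 := by positivity
  have h2 := mul_left_cancel₀ hk' h1
  have h3 : inner ℝ (cosL2 k) (cosL2 k) + inner ℝ (sinL2 k) (sinL2 k) = 2 * Real.pi := by
    rw [inner_L2, inner_L2, ← intervalIntegral.integral_add]
    · rw [integral_congr_of_ae_mu (g := fun _ => 1) _ right_mem_Icc_two_pi]
      · simp
      · filter_upwards [coeFn_cosL2 k, coeFn_sinL2 k] with t h1 h2
        rw [h1, h2]
        linear_combination Real.cos_sq_add_sin_sq (k * t)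
    all_goals exact intervalIntegrable_mul_coe _ _
  rw [h2] at h3 ⊢
  constructor <;> linarith

/-! ### Trigonometric polynomials and the projections -/

/-- The trigonometric polynomial with constant term `m` and coefficients `α`, `β`. -/
def trigPoly (n : ℕ) (m : ℝ) (α β : ℕ → ℝ) : L2 :=
  m • cosL2 0 + ∑ k ∈ Finset.Icc 1 n, (α k • cosL2 k + β k • sinL2 k)

theorem inner_trigPoly_right (f : L2) (n : ℕ) (m : ℝ) (α β : ℕ → ℝ) :
    inner ℝ f (trigPoly n m α β) = m * inner ℝ f (cosL2 0) +
      ∑ k ∈ Finset.Icc 1 n, (α k * inner ℝ f (cosL2 k) + β k * inner ℝ f (sinL2 k)) := by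
  simp [trigPoly, inner_add_right, inner_sum, inner_smul_right]

theorem inner_trigPoly_cosL2_zero (n : ℕ) (m : ℝ) (α β : ℕ → ℝ) :
    inner ℝ (trigPoly n m α β) (cosL2 0) = 2 * Real.pi * m := by
  rw [real_inner_comm, inner_trigPoly_right, Finset.sum_eq_zero]
  · rw [inner_cosL2_zero_self]; ring
  · intro k hk
    have hk0 : k ≠ 0 := by have := (Finset.mem_Icc.1 hk).1; omega
    rw [inner_cosL2_sinL2, real_inner_comm, inner_cosL2_one hk0]; ring

theorem inner_trigPoly_cosL2 (n : ℕ) (m : ℝ) (α β : ℕ → ℝ) {j : ℕ} (hj : j ≠ 0) :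
    inner ℝ (trigPoly n m α β) (cosL2 j) = if j ≤ n then Real.pi * α j else 0 := by
  rw [real_inner_comm, inner_trigPoly_right, inner_cosL2_one hj]
  have h : ∀ k ∈ Finset.Icc 1 n, α k * inner ℝ (cosL2 j) (cosL2 k) +
      β k * inner ℝ (cosL2 j) (sinL2 k) = if k = j then Real.pi * α j else 0 := by
    intro k hk
    have hk0 : k ≠ 0 := by have := (Finset.mem_Icc.1 hk).1; omega
    rw [inner_cosL2_sinL2]
    split_ifs with h
    · rw [h, (inner_trig_self hj).1]; ring
    · rw [(inner_trig_of_ne hj hk0 (Ne.symm h)).1]; ring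
  rw [Finset.sum_congr rfl h, Finset.sum_ite_eq']
  simp [Nat.one_le_iff_ne_zero, hj]

theorem inner_trigPoly_sinL2 (n : ℕ) (m : ℝ) (α β : ℕ → ℝ) {j : ℕ} (hj : j ≠ 0) :
    inner ℝ (trigPoly n m α β) (sinL2 j) = if j ≤ n then Real.pi * β j else 0 := by
  rw [real_inner_comm, inner_trigPoly_right, inner_sinL2_one]
  have h : ∀ k ∈ Finset.Icc 1 n, α k * inner ℝ (sinL2 j) (cosL2 k) +
      β k * inner ℝ (sinL2 j) (sinL2 k) = if k = j then Real.pi * β j else 0 := by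
    intro k hk
    have hk0 : k ≠ 0 := by have := (Finset.mem_Icc.1 hk).1; omega
    rw [real_inner_comm, inner_cosL2_sinL2]
    split_ifs with h
    · rw [h, (inner_trig_self hj).2]; ring
    · rw [(inner_trig_of_ne hj hk0 (Ne.symm h)).2]; ring
  rw [Finset.sum_congr rfl h, Finset.sum_ite_eq']
  simp [Nat.one_le_iff_ne_zero, hj]

theorem inner_trigPoly_trigPoly (n : ℕ) (m m' : ℝ) (α β α' β' : ℕ → ℝ) :
    inner ℝ (trigPoly n m α β) (trigPoly n m' α' β') = 2 * Real.pi * (m * m') +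
      Real.pi * ∑ k ∈ Finset.Icc 1 n, (α k * α' k + β k * β' k) := by
  rw [inner_trigPoly_right, inner_trigPoly_cosL2_zero, Finset.mul_sum]
  congr 1
  · ring
  · refine Finset.sum_congr rfl fun k hk => ?_
    have hk' := Finset.mem_Icc.1 hk
    rw [inner_trigPoly_cosL2 _ _ _ _ (by omega), inner_trigPoly_sinL2 _ _ _ _ (by omega),
      if_pos hk'.2, if_pos hk'.2]
    ring

theorem norm_sq_trigPoly (n : ℕ) (m : ℝ) (α β : ℕ → ℝ) :
    ‖trigPoly n m α β‖ ^ 2 = 2 * Real.pi * m ^ 2 +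
      Real.pi * ∑ k ∈ Finset.Icc 1 n, (α k ^ 2 + β k ^ 2) := by
  rw [← real_inner_self_eq_norm_sq, inner_trigPoly_trigPoly]
  simp only [sq]

theorem cosL2_zero_mem_trigSpace (n : ℕ) : cosL2 0 ∈ trigSpace n := by
  have h : (1 / Real.sqrt (2 * Real.pi)) • cosL2 0 ∈ trigSpace n :=
    Submodule.subset_span (Or.inl (Or.inl rfl))
  refine ((trigSpace n).smul_mem_iff ?_).1 h
  positivity

theorem cosL2_mem_trigSpace {n k : ℕ} (hk : k ∈ Icc 1 n) : cosL2 k ∈ trigSpace n := by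
  have h : (1 / Real.sqrt Real.pi) • cosL2 k ∈ trigSpace n :=
    Submodule.subset_span (Or.inl (Or.inr ⟨k, hk, rfl⟩))
  refine ((trigSpace n).smul_mem_iff ?_).1 h
  positivity

theorem sinL2_mem_trigSpace {n k : ℕ} (hk : k ∈ Icc 1 n) : sinL2 k ∈ trigSpace n := by
  have h : (1 / Real.sqrt Real.pi) • sinL2 k ∈ trigSpace n :=
    Submodule.subset_span (Or.inr ⟨k, hk, rfl⟩)
  refine ((trigSpace n).smul_mem_iff ?_).1 h
  positivity

theorem trigPoly_mem_trigSpace (n : ℕ) (m : ℝ) (α β : ℕ → ℝ) :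
    trigPoly n m α β ∈ trigSpace n := by
  refine add_mem (Submodule.smul_mem _ _ (cosL2_zero_mem_trigSpace n)) (sum_mem fun k hk => ?_)
  have hk' : k ∈ Icc 1 n := Finset.mem_Icc.1 hk
  exact add_mem (Submodule.smul_mem _ _ (cosL2_mem_trigSpace hk'))
    (Submodule.smul_mem _ _ (sinL2_mem_trigSpace hk'))

theorem mem_trigSpace_orthogonal {n : ℕ} {f : L2} (h0 : inner ℝ f (cosL2 0) = 0)
    (hc : ∀ k, 1 ≤ k → k ≤ n → inner ℝ f (cosL2 k) = 0)
    (hs : ∀ k, 1 ≤ k → k ≤ n → inner ℝ f (sinL2 k) = 0) : f ∈ (trigSpace n)ᗮ := by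
  rw [Submodule.mem_orthogonal]
  intro u hu
  rw [real_inner_comm]
  induction hu using Submodule.span_induction with
  | mem x hx =>
    rcases hx with (hx | ⟨k, hk, rfl⟩) | ⟨k, hk, rfl⟩
    · rw [mem_singleton_iff.1 hx, inner_smul_right, h0, mul_zero]
    · rw [inner_smul_right, hc k hk.1 hk.2, mul_zero]
    · rw [inner_smul_right, hs k hk.1 hk.2, mul_zero]
  | zero => exact inner_zero_right _
  | add x y _ _ hx hy => rw [inner_add_right, hx, hy, add_zero]
  | smul a x _ hx => rw [inner_smul_right, hx, mul_zero]

/-- The projection `P_n` as an operator on `L²`. -/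
def proj (n : ℕ) (f : L2) : L2 := (projX n f : L2)

theorem proj_mem (n : ℕ) (f : L2) : proj n f ∈ trigSpace n := (projX n f).2

theorem sub_proj_mem (n : ℕ) (f : L2) : f - proj n f ∈ (trigSpace n)ᗮ :=
  Submodule.sub_starProjection_mem_orthogonal f

theorem proj_eq_self {n : ℕ} {f : L2} (hf : f ∈ trigSpace n) : proj n f = f :=
  Submodule.starProjection_eq_self_iff.2 hf

theorem inner_proj_right {n : ℕ} {g : L2} (f : L2) (hg : g ∈ trigSpace n) :
    inner ℝ (proj n f) g = inner ℝ f g := by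
  have h := Submodule.inner_left_of_mem_orthogonal hg (sub_proj_mem n f)
  rw [inner_sub_left] at h
  linarith

theorem inner_sub_proj {n : ℕ} {g : L2} (f : L2) (hg : g ∈ (trigSpace n)ᗮ) :
    inner ℝ g (f - proj n f) = inner ℝ g f := by
  rw [inner_sub_right, Submodule.inner_left_of_mem_orthogonal (proj_mem n f) hg, sub_zero]

theorem proj_eq_trigPoly (n : ℕ) (f : L2) :
    proj n f = trigPoly n (inner ℝ f (cosL2 0) / (2 * Real.pi))
      (fun k => inner ℝ f (cosL2 k) / Real.pi) fun k => inner ℝ f (sinL2 k) / Real.pi := by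
  have hpi := Real.pi_ne_zero
  refine (Submodule.eq_starProjection_of_mem_orthogonal (trigPoly_mem_trigSpace _ _ _ _) ?_)
  refine mem_trigSpace_orthogonal ?_ (fun k h1 hk => ?_) (fun k h1 hk => ?_)
  · rw [inner_sub_left, inner_trigPoly_cosL2_zero]; field_simp; ring
  · rw [inner_sub_left, inner_trigPoly_cosL2 _ _ _ _ (by omega), if_pos hk]; field_simp; ring
  · rw [inner_sub_left, inner_trigPoly_sinL2 _ _ _ _ (by omega), if_pos hk]; field_simp; ring

/-! ### Parseval's identity -/

theorem hasSum_of_forall_eq {f g : ℕ → ℝ} {a : ℝ} (hf : HasSum f a) (h : ∀ k, g k = f k) :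
    HasSum g a := by
  rwa [funext h]

theorem intervalIntegrable_ofReal {g : ℝ → ℝ} {a b : ℝ} (hg : IntervalIntegrable g volume a b) :
    IntervalIntegrable (fun x => (g x : ℂ)) volume a b :=
  ⟨hg.1.ofReal, hg.2.ofReal⟩

theorem fourierCoeffOn_coe (f : L2) (k : ℤ) :
    fourierCoeffOn Real.two_pi_pos (fun x => (f x : ℂ)) k =
      ((1 / (2 * Real.pi) * ∫ x in (0 : ℝ)..(2 * Real.pi), f x * Real.cos (k * x) : ℝ) : ℂ) -
      ((1 / (2 * Real.pi) * ∫ x in (0 : ℝ)..(2 * Real.pi), f x * Real.sin (k * x) : ℝ) : ℂ) *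
        Complex.I := by
  have hc : IntervalIntegrable (fun x => f x * Real.cos (k * x)) volume 0 (2 * Real.pi) :=
    (intervalIntegrable_coe f).mul_continuousOn (by fun_prop)
  have hs : IntervalIntegrable (fun x => f x * Real.sin (k * x)) volume 0 (2 * Real.pi) :=
    (intervalIntegrable_coe f).mul_continuousOn (by fun_prop)
  rw [fourierCoeffOn_eq_integral]
  have h : ∀ x : ℝ, fourier (-k) (x : AddCircle (2 * Real.pi - 0)) • (f x : ℂ) =
      ((f x * Real.cos (k * x) : ℝ) : ℂ) - ((f x * Real.sin (k * x) : ℝ) : ℂ) * Complex.I := by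
    intro x
    rw [fourier_coe_apply]
    have : 2 * (Real.pi : ℂ) * Complex.I * ((-k : ℤ) : ℂ) * x / ((2 * Real.pi - 0 : ℝ) : ℂ) =
        ((-(k * x) : ℝ) : ℂ) * Complex.I := by
      have : (Real.pi : ℂ) ≠ 0 := Complex.ofReal_ne_zero.2 Real.pi_ne_zero
      push_cast
      field_simp
      ring
    rw [this, Complex.exp_mul_I, ← Complex.ofReal_cos, ← Complex.ofReal_sin, Real.cos_neg,
      Real.sin_neg, smul_eq_mul]
    push_cast
    ring
  simp only [h]
  rw [intervalIntegral.integral_sub, intervalIntegral.integral_mul_const,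
    intervalIntegral.integral_ofReal, intervalIntegral.integral_ofReal, sub_zero,
    Complex.real_smul]
  · push_cast
    ring
  · exact intervalIntegrable_ofReal hc
  · exact (intervalIntegrable_ofReal hs).mul_const _

/-- The complex Parseval identity on (0, 2π), with the frequencies k and -k combined. -/
theorem hasSum_inner_sq (f : L2) :
    HasSum (fun k : ℕ => (inner ℝ f (cosL2 (k + 1)) ^ 2 + inner ℝ f (sinL2 (k + 1)) ^ 2) / Real.pi)
      (‖f‖ ^ 2 - inner ℝ f (cosL2 0) ^ 2 / (2 * Real.pi)) := by
  have hpi := Real.pi_ne_zero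
  have hmem : MemLp (fun x => (f x : ℂ)) 2 (volume.restrict (Ioc 0 (2 * Real.pi))) := by
    rw [← restrict_Ioo_eq_restrict_Ioc]
    exact (Lp.memLp f).ofReal
  have h := (hasSum_sq_fourierCoeffOn Real.two_pi_pos hmem).nat_add_neg
  have hnorm : ∫ x in (0 : ℝ)..(2 * Real.pi), ‖(f x : ℂ)‖ ^ 2 = ‖f‖ ^ 2 := by
    rw [← real_inner_self_eq_norm_sq, inner_L2]
    simp [sq]
  have hsq : ∀ a b : ℝ, ‖(a : ℂ) - (b : ℂ) * Complex.I‖ ^ 2 = a ^ 2 + b ^ 2 := by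
    intro a b
    rw [← Complex.normSq_eq_norm_sq, Complex.normSq_apply]
    simp [sq]
  have hcoef : ∀ k : ℤ, ‖fourierCoeffOn Real.two_pi_pos (fun x => (f x : ℂ)) k‖ ^ 2 =
      (1 / (2 * Real.pi)) ^ 2 * ((∫ x in (0 : ℝ)..(2 * Real.pi), f x * Real.cos (k * x)) ^ 2 +
        (∫ x in (0 : ℝ)..(2 * Real.pi), f x * Real.sin (k * x)) ^ 2) := by
    intro k
    rw [fourierCoeffOn_coe, hsq]
    ring
  have hpos : ∀ k : ℕ, ‖fourierCoeffOn Real.two_pi_pos (fun x => (f x : ℂ)) (k : ℤ)‖ ^ 2 =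
      (1 / (2 * Real.pi)) ^ 2 * (inner ℝ f (cosL2 k) ^ 2 + inner ℝ f (sinL2 k) ^ 2) := by
    intro k
    rw [hcoef, inner_cosL2, inner_sinL2]
    norm_cast
  have hneg : ∀ k : ℕ, ‖fourierCoeffOn Real.two_pi_pos (fun x => (f x : ℂ)) (-(k : ℤ))‖ ^ 2 =
      (1 / (2 * Real.pi)) ^ 2 * (inner ℝ f (cosL2 k) ^ 2 + inner ℝ f (sinL2 k) ^ 2) := by
    intro k
    rw [hcoef, inner_cosL2, inner_sinL2]
    simp [neg_mul]
  have hz : ‖fourierCoeffOn Real.two_pi_pos (fun x => (f x : ℂ)) 0‖ ^ 2 =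
      (1 / (2 * Real.pi)) ^ 2 * inner ℝ f (cosL2 0) ^ 2 := by
    rw [hcoef, inner_cosL2]
    simp
  simp only [hpos, hneg] at h
  rw [hz, hnorm] at h
  -- Combining k with -k counts the zeroth coefficient twice, so the total is the full sum plus one
  -- extra copy; both copies are removed with the index 0.
  have h2 := ((hasSum_nat_add_iff' 1).2 h).mul_left (2 * Real.pi)
  have h0 : inner ℝ f (sinL2 0) = (0 : ℝ) := by rw [inner_sinL2]; simp
  rw [Finset.sum_range_one, h0, sub_zero, smul_eq_mul] at h2
  have hval : ‖f‖ ^ 2 - inner ℝ f (cosL2 0) ^ 2 / (2 * Real.pi) =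
      2 * Real.pi * ((2 * Real.pi)⁻¹ * ‖f‖ ^ 2 +
        (1 / (2 * Real.pi)) ^ 2 * inner ℝ f (cosL2 0) ^ 2 -
        ((1 / (2 * Real.pi)) ^ 2 * (inner ℝ f (cosL2 0) ^ 2 + 0 ^ 2) +
          (1 / (2 * Real.pi)) ^ 2 * (inner ℝ f (cosL2 0) ^ 2 + 0 ^ 2))) := by
    field_simp
    ring
  rw [hval]
  refine hasSum_of_forall_eq h2 fun k => ?_
  field_simp
  ring

/-- The squared distance to `X_n` is the tail of the Fourier series. -/
theorem hasSum_norm_sub_proj_sq (n : ℕ) (f : L2) :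
    HasSum (fun k : ℕ => (inner ℝ f (cosL2 (n + k + 1)) ^ 2 +
      inner ℝ f (sinL2 (n + k + 1)) ^ 2) / Real.pi) (‖f - proj n f‖ ^ 2) := by
  have hmem := sub_proj_mem n f
  have hlow : ∀ g ∈ trigSpace n, inner ℝ (f - proj n f) g = 0 := fun g hg =>
    Submodule.inner_left_of_mem_orthogonal hg hmem
  have h := (hasSum_nat_add_iff' n).2 (hasSum_inner_sq (f - proj n f))
  rw [hlow _ (cosL2_zero_mem_trigSpace n), Finset.sum_eq_zero] at h
  · rw [show ‖f - proj n f‖ ^ 2 = ‖f - proj n f‖ ^ 2 - 0 ^ 2 / (2 * Real.pi) - 0 by ring]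
    refine hasSum_of_forall_eq h fun k => ?_
    rw [proj_eq_trigPoly, inner_sub_left, inner_sub_left, inner_trigPoly_cosL2 _ _ _ _ (by omega),
      inner_trigPoly_sinL2 _ _ _ _ (by omega), if_neg (by omega), if_neg (by omega), sub_zero,
      sub_zero, add_comm n k]
  · intro k hk
    have hk' : k + 1 ∈ Icc 1 n := ⟨by omega, Finset.mem_range.1 hk⟩
    rw [hlow _ (cosL2_mem_trigSpace hk'), hlow _ (sinL2_mem_trigSpace hk')]
    simp

/-! ### The Dirichlet kernel and the sawtooth function -/

/-- The Dirichlet kernel `1 + 2 ∑ cos (k t)`. -/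
def dirichlet (n : ℕ) : L2 := trigPoly n 1 (fun _ => 2) 0

/-- The negative derivative `2 ∑ k sin (k t)` of the Dirichlet kernel. -/
def dirichletOne (n : ℕ) : L2 := trigPoly n 0 0 fun k => 2 * k

/-- The negative second derivative `2 ∑ k² cos (k t)` of the Dirichlet kernel. -/
def dirichletTwo (n : ℕ) : L2 := trigPoly n 0 (fun k => 2 * (k : ℝ) ^ 2) 0

/-- The sawtooth function `π - t`. -/
def sawtooth : L2 := Real.pi • cosL2 0 - opA 1 (cosL2 0)

/-- The part `(I - P_n)(π - t)` of the sawtooth function. -/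
def sawtoothTail (n : ℕ) : L2 := sawtooth - proj n sawtooth

/-- The primitive with mean value zero. -/
def meanFreePrimitive (h : L2) : L2 :=
  opA 1 h - (inner ℝ (opA 1 h) (cosL2 0) / (2 * Real.pi)) • cosL2 0

/-- The derivative of the projection onto `X_n`. -/
def trigDeriv (n : ℕ) (f : L2) : L2 :=
  trigPoly n 0 (fun k => k * inner ℝ f (sinL2 k) / Real.pi)
    fun k => -(k * inner ℝ f (cosL2 k) / Real.pi)

theorem inner_opA_one_cosL2_zero (f : L2) :
    inner ℝ (opA 1 f) (cosL2 0) = Real.pi * inner ℝ f (cosL2 0) + inner ℝ f sawtooth := by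
  rw [inner_opA_one, inner_cosL2_zero_self, sawtooth, inner_sub_right, inner_smul_right]; ring

theorem inner_sawtooth_cosL2_zero : inner ℝ sawtooth (cosL2 0) = 0 := by
  have h1 := inner_opA_one (cosL2 0) (cosL2 0)
  rw [real_inner_comm (opA 1 (cosL2 0)), inner_cosL2_zero_self] at h1
  rw [sawtooth, inner_sub_left, inner_smul_left, inner_cosL2_zero_self]
  simp only [RCLike.conj_to_real]
  linarith

theorem inner_sawtooth_cosL2 {k : ℕ} (hk : k ≠ 0) : inner ℝ sawtooth (cosL2 k) = 0 := by
  rw [sawtooth, inner_sub_left, inner_smul_left, inner_opA_one_cosL2 _ hk, inner_cosL2_sinL2,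
    real_inner_comm, inner_cosL2_one hk]
  simp

theorem inner_sawtooth_sinL2 {k : ℕ} (hk : k ≠ 0) :
    inner ℝ sawtooth (sinL2 k) = 2 * Real.pi / k := by
  rw [sawtooth, inner_sub_left, inner_smul_left, inner_opA_one_sinL2 _ hk, inner_cosL2_sinL2,
    real_inner_comm, inner_cosL2_one hk, inner_cosL2_zero_self]
  simp
  ring

theorem sawtoothTail_mem (n : ℕ) : sawtoothTail n ∈ (trigSpace n)ᗮ := sub_proj_mem n _

/-- Telescoping from 1/j² ≤ 1/(j - 1/2) - 1/(j + 1/2). The half-integers matter: they give 2/(2n+1),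
which cancels exactly against ‖D_n‖² = 2π(2n+1). -/
theorem sum_range_inv_sq_le (n m : ℕ) :
    ∑ k ∈ Finset.range m, 1 / ((n + k + 1 : ℕ) : ℝ) ^ 2 ≤
      2 / (2 * (n : ℝ) + 1) - 2 / (2 * ((n : ℝ) + m) + 1) := by
  induction m with
  | zero => simp
  | succ m ih =>
    rw [Finset.sum_range_succ]
    have : 1 / ((n + m + 1 : ℕ) : ℝ) ^ 2 ≤
        2 / (2 * ((n : ℝ) + m) + 1) - 2 / (2 * ((n : ℝ) + (m + 1 : ℕ)) + 1) := by
      push_cast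
      rw [div_sub_div _ _ (by positivity) (by positivity), div_le_div_iff₀ (by positivity)
        (by positivity)]
      nlinarith
    linarith

theorem norm_sq_sawtoothTail_le (n : ℕ) :
    ‖sawtoothTail n‖ ^ 2 ≤ 8 * Real.pi / (2 * n + 1) := by
  have hpi := Real.pi_pos
  refine le_of_tendsto' (hasSum_norm_sub_proj_sq n sawtooth).tendsto_sum_nat fun m => ?_
  have : ∀ k ∈ Finset.range m, (inner ℝ sawtooth (cosL2 (n + k + 1)) ^ 2 +
      inner ℝ sawtooth (sinL2 (n + k + 1)) ^ 2) / Real.pi =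
      4 * Real.pi * (1 / ((n + k + 1 : ℕ) : ℝ) ^ 2) := by
    intro k _
    rw [inner_sawtooth_cosL2 (by omega), inner_sawtooth_sinL2 (by omega)]
    field_simp
    ring
  rw [Finset.sum_congr rfl this, ← Finset.mul_sum]
  calc 4 * Real.pi * ∑ k ∈ Finset.range m, 1 / ((n + k + 1 : ℕ) : ℝ) ^ 2
      ≤ 4 * Real.pi * (2 / (2 * n + 1)) := by
        refine mul_le_mul_of_nonneg_left ((sum_range_inv_sq_le n m).trans ?_) (by positivity)
        have : (0 : ℝ) ≤ 2 / (2 * ((n : ℝ) + m) + 1) := by positivity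
        linarith
    _ = _ := by ring

/-- The adjoint of integration maps D_n to its integral over (x, 2π), namely π plus the sawtooth
minus its own Fourier polynomial of degree n. -/
theorem inner_opA_one_dirichlet (n : ℕ) (f : L2) :
    inner ℝ (opA 1 f) (dirichlet n) =
      Real.pi * inner ℝ f (cosL2 0) + inner ℝ f (sawtoothTail n) := by
  have hpi := Real.pi_ne_zero
  rw [dirichlet, inner_trigPoly_right, sawtoothTail, inner_sub_right, proj_eq_trigPoly,
    inner_trigPoly_right, inner_opA_one_cosL2_zero, inner_sawtooth_cosL2_zero]
  have : ∀ k ∈ Finset.Icc 1 n, 2 * inner ℝ (opA 1 f) (cosL2 k) +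
      (0 : ℕ → ℝ) k * inner ℝ (opA 1 f) (sinL2 k) =
      -(inner ℝ sawtooth (cosL2 k) / Real.pi * inner ℝ f (cosL2 k) +
        inner ℝ sawtooth (sinL2 k) / Real.pi * inner ℝ f (sinL2 k)) := by
    intro k hk
    have hk0 : k ≠ 0 := by have := (Finset.mem_Icc.1 hk).1; omega
    rw [inner_opA_one_cosL2 f hk0, inner_sawtooth_cosL2 hk0, inner_sawtooth_sinL2 hk0,
      Pi.zero_apply]
    field_simp
    ring
  rw [Finset.sum_congr rfl this, Finset.sum_neg_distrib]
  ring

/-- Here the adjoint of integration returns D_n minus its endpoint value D_n(2π) = 2n + 1; this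
value becomes the lower off-diagonal entry of the system for the means. -/
theorem inner_opA_one_dirichletOne (n : ℕ) (f : L2) :
    inner ℝ (opA 1 f) (dirichletOne n) =
      inner ℝ f (dirichlet n) - (2 * n + 1) * inner ℝ f (cosL2 0) := by
  rw [dirichletOne, dirichlet, inner_trigPoly_right, inner_trigPoly_right]
  have : ∀ k ∈ Finset.Icc 1 n, (0 : ℕ → ℝ) k * inner ℝ (opA 1 f) (cosL2 k) +
      2 * k * inner ℝ (opA 1 f) (sinL2 k) =
      2 * inner ℝ f (cosL2 k) + (0 : ℕ → ℝ) k * inner ℝ f (sinL2 k) -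
        2 * inner ℝ f (cosL2 0) := by
    intro k hk
    have hk0 : k ≠ 0 := by have := (Finset.mem_Icc.1 hk).1; omega
    have hk1 : (k : ℝ) ≠ 0 := Nat.cast_ne_zero.2 hk0
    rw [inner_opA_one_sinL2 f hk0, Pi.zero_apply]
    field_simp
    ring
  rw [Finset.sum_congr rfl this, Finset.sum_sub_distrib, Finset.sum_const, Nat.card_Icc,
    nsmul_eq_mul, Nat.add_sub_cancel]
  ring

theorem inner_opA_one_dirichletTwo (n : ℕ) (f : L2) :
    inner ℝ (opA 1 f) (dirichletTwo n) = -inner ℝ f (dirichletOne n) := by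
  rw [dirichletOne, dirichletTwo, inner_trigPoly_right, inner_trigPoly_right, zero_mul, zero_mul,
    zero_add, zero_add, ← Finset.sum_neg_distrib]
  refine Finset.sum_congr rfl fun k hk => ?_
  have hk0 : k ≠ 0 := by have := (Finset.mem_Icc.1 hk).1; omega
  have hk1 : (k : ℝ) ≠ 0 := Nat.cast_ne_zero.2 hk0
  rw [inner_opA_one_cosL2 f hk0, Pi.zero_apply]
  field_simp
  ring

/-! ### Mean-free primitives of functions orthogonal to `X_n` -/

theorem inner_meanFreePrimitive_cosL2_zero (h : L2) :
    inner ℝ (meanFreePrimitive h) (cosL2 0) = 0 := by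
  have := Real.pi_ne_zero
  rw [meanFreePrimitive, inner_sub_left, inner_smul_left, inner_cosL2_zero_self]
  simp only [RCLike.conj_to_real]
  field_simp
  ring

theorem inner_meanFreePrimitive_cosL2 (h : L2) {k : ℕ} (hk : k ≠ 0) :
    inner ℝ (meanFreePrimitive h) (cosL2 k) = -(1 / (k : ℝ)) * inner ℝ h (sinL2 k) := by
  rw [meanFreePrimitive, inner_sub_left, inner_smul_left, real_inner_comm (cosL2 k) (cosL2 0),
    inner_cosL2_one hk, inner_opA_one_cosL2 h hk]
  ring

theorem inner_meanFreePrimitive_sinL2 {h : L2} (h0 : inner ℝ h (cosL2 0) = 0) {k : ℕ}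
    (hk : k ≠ 0) : inner ℝ (meanFreePrimitive h) (sinL2 k) = 1 / (k : ℝ) * inner ℝ h (cosL2 k) := by
  rw [meanFreePrimitive, inner_sub_left, inner_smul_left, inner_cosL2_sinL2,
    inner_opA_one_sinL2 h hk, h0]
  ring

theorem meanFreePrimitive_mem {n : ℕ} {h : L2} (hh : h ∈ (trigSpace n)ᗮ) :
    meanFreePrimitive h ∈ (trigSpace n)ᗮ := by
  refine mem_trigSpace_orthogonal (inner_meanFreePrimitive_cosL2_zero h) (fun k h1 hk => ?_)
    fun k h1 hk => ?_
  · rw [inner_meanFreePrimitive_cosL2 h (by omega),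
      Submodule.inner_left_of_mem_orthogonal (sinL2_mem_trigSpace ⟨h1, hk⟩) hh, mul_zero]
  · rw [inner_meanFreePrimitive_sinL2
      (Submodule.inner_left_of_mem_orthogonal (cosL2_zero_mem_trigSpace n) hh) (by omega),
      Submodule.inner_left_of_mem_orthogonal (cosL2_mem_trigSpace ⟨h1, hk⟩) hh, mul_zero]

theorem proj_eq_zero {n : ℕ} {h : L2} (hh : h ∈ (trigSpace n)ᗮ) : proj n h = 0 :=
  (Submodule.starProjection_apply_eq_zero_iff _).2 hh

theorem norm_meanFreePrimitive_le {n : ℕ} {h : L2} (hh : h ∈ (trigSpace n)ᗮ) :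
    n * ‖meanFreePrimitive h‖ ≤ ‖h‖ := by
  have h1 := (hasSum_norm_sub_proj_sq n (meanFreePrimitive h)).mul_left ((n : ℝ) ^ 2)
  have h2 := hasSum_norm_sub_proj_sq n h
  rw [proj_eq_zero (meanFreePrimitive_mem hh), sub_zero] at h1
  rw [proj_eq_zero hh, sub_zero] at h2
  have h3 : (n : ℝ) ^ 2 * ‖meanFreePrimitive h‖ ^ 2 ≤ ‖h‖ ^ 2 := by
    refine hasSum_le (fun k => ?_) h1 h2
    rw [inner_meanFreePrimitive_cosL2 h (by omega), inner_meanFreePrimitive_sinL2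
      (Submodule.inner_left_of_mem_orthogonal (cosL2_zero_mem_trigSpace n) hh) (by omega)]
    have hn : (n : ℝ) ^ 2 * (1 / ((n + k + 1 : ℕ) : ℝ)) ^ 2 ≤ 1 := by
      rw [← mul_pow]
      refine pow_le_one₀ (by positivity) ?_
      rw [mul_one_div, div_le_one (by positivity)]
      push_cast
      linarith [(Nat.cast_nonneg k : (0 : ℝ) ≤ k)]
    set a : ℝ := inner ℝ h (cosL2 (n + k + 1))
    set b : ℝ := inner ℝ h (sinL2 (n + k + 1))
    calc _ = ((n : ℝ) ^ 2 * (1 / ((n + k + 1 : ℕ) : ℝ)) ^ 2) * ((a ^ 2 + b ^ 2) / Real.pi) := by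
          ring
      _ ≤ 1 * ((a ^ 2 + b ^ 2) / Real.pi) :=
          mul_le_mul_of_nonneg_right hn (by positivity)
      _ = _ := one_mul _
  rw [← mul_pow] at h3
  exact le_of_sq_le_sq h3 (norm_nonneg _)

/-- As h has mean zero, the boundary term of the integration by parts drops out. Splitting the
primitive of h into its mean-free part and its mean leaves the mean of f as the only extra term. -/
theorem inner_opA_one_of_orthogonal {n : ℕ} {h : L2} (hh : h ∈ (trigSpace n)ᗮ) (f : L2) :
    inner ℝ (opA 1 f) h = -inner ℝ f (meanFreePrimitive h) -
      inner ℝ h sawtooth / (2 * Real.pi) * inner ℝ f (cosL2 0) := by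
  have h0 : inner ℝ h (cosL2 0) = 0 :=
    Submodule.inner_left_of_mem_orthogonal (cosL2_zero_mem_trigSpace n) hh
  rw [inner_opA_one, h0, meanFreePrimitive, inner_sub_right, inner_smul_right,
    inner_opA_one_cosL2_zero h, h0]
  ring

theorem inner_opA_one_sawtoothTail (n : ℕ) (f : L2) :
    inner ℝ (opA 1 f) (sawtoothTail n) =
      -inner ℝ f (meanFreePrimitive (sawtoothTail n)) -
        ‖sawtoothTail n‖ ^ 2 / (2 * Real.pi) * inner ℝ f (cosL2 0) := by
  rw [inner_opA_one_of_orthogonal (sawtoothTail_mem n),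
    ← inner_sub_proj sawtooth (sawtoothTail_mem n), ← real_inner_self_eq_norm_sq]
  rfl

/-- No mean of f appears here, since a mean-free function is orthogonal to its mean-free primitive.
This keeps the system for p = 3 tridiagonal. -/
theorem inner_opA_one_meanFreePrimitive_sawtoothTail (n : ℕ) (f : L2) :
    inner ℝ (opA 1 f) (meanFreePrimitive (sawtoothTail n)) =
      -inner ℝ f (meanFreePrimitive (meanFreePrimitive (sawtoothTail n))) := by
  have hR := sawtoothTail_mem n
  have h0 : inner ℝ (sawtoothTail n) (cosL2 0) = 0 :=
    Submodule.inner_left_of_mem_orthogonal (cosL2_zero_mem_trigSpace n) hR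
  have h1 : inner ℝ (meanFreePrimitive (sawtoothTail n)) (sawtoothTail n) = 0 := by
    have h2 := inner_opA_one (sawtoothTail n) (sawtoothTail n)
    rw [h0, real_inner_comm (opA 1 _)] at h2
    rw [meanFreePrimitive, inner_sub_left, inner_smul_left, real_inner_comm _ (cosL2 0), h0]
    linarith
  rw [inner_opA_one_of_orthogonal (meanFreePrimitive_mem hR),
    ← inner_sub_proj sawtooth (meanFreePrimitive_mem hR)]
  change _ - inner ℝ _ (sawtoothTail n) / _ * _ = _
  rw [h1]
  ring

/-! ### Reconstructing the projection from the primitive -/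

/-- Bernstein's inequality in L²: differentiation multiplies each frequency by at most n. -/
theorem norm_trigDeriv_le (n : ℕ) (f : L2) : ‖trigDeriv n f‖ ≤ n * ‖proj n f‖ := by
  have h : ‖trigDeriv n f‖ ^ 2 ≤ (n * ‖proj n f‖) ^ 2 := by
    rw [mul_pow, trigDeriv, proj_eq_trigPoly, norm_sq_trigPoly, norm_sq_trigPoly]
    have : ∑ k ∈ Finset.Icc 1 n, ((k * inner ℝ f (sinL2 k) / Real.pi) ^ 2 +
        (-(k * inner ℝ f (cosL2 k) / Real.pi)) ^ 2) ≤
        n ^ 2 * ∑ k ∈ Finset.Icc 1 n, ((inner ℝ f (cosL2 k) / Real.pi) ^ 2 +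
          (inner ℝ f (sinL2 k) / Real.pi) ^ 2) := by
      rw [Finset.mul_sum]
      refine Finset.sum_le_sum fun k hk => ?_
      have hk' : (k : ℝ) ^ 2 ≤ n ^ 2 := by
        have : (k : ℝ) ≤ n := by exact_mod_cast (Finset.mem_Icc.1 hk).2
        gcongr
      calc _ = (k : ℝ) ^ 2 * ((inner ℝ f (cosL2 k) / Real.pi) ^ 2 +
          (inner ℝ f (sinL2 k) / Real.pi) ^ 2) := by ring
        _ ≤ _ := mul_le_mul_of_nonneg_right hk' (by positivity)
    have h2 := mul_le_mul_of_nonneg_left this Real.pi_pos.le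
    have h3 : 0 ≤ (n : ℝ) ^ 2 * (2 * Real.pi * (inner ℝ f (cosL2 0) / (2 * Real.pi)) ^ 2) := by
      have := Real.pi_pos
      positivity
    linarith
  exact le_of_sq_le_sq h (by positivity)

/-- Every sine coefficient of the primitive carries the same offset, the mean of f; after
differentiation these offsets add up to a multiple of the Dirichlet kernel. -/
theorem proj_eq_trigDeriv_add (n : ℕ) (f : L2) :
    proj n f = trigDeriv n (opA 1 f) +
      (inner ℝ f (cosL2 0) / (2 * Real.pi)) • dirichlet n := by
  have hpi := Real.pi_ne_zero
  rw [proj_eq_trigPoly, trigDeriv, dirichlet, trigPoly, trigPoly, trigPoly, smul_add, smul_smul,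
    mul_one, zero_smul, zero_add, add_left_comm, Finset.smul_sum, ← Finset.sum_add_distrib]
  congr 1
  refine Finset.sum_congr rfl fun k hk => ?_
  have hk0 : k ≠ 0 := by have := (Finset.mem_Icc.1 hk).1; omega
  have hk1 : (k : ℝ) ≠ 0 := Nat.cast_ne_zero.2 hk0
  rw [inner_opA_one_cosL2 f hk0, inner_opA_one_sinL2 f hk0, Pi.zero_apply, zero_smul, add_zero,
    smul_smul, add_right_comm, ← add_smul]
  congr 2
  · field_simp
    ring
  · field_simp

theorem inner_trigDeriv_dirichlet (n : ℕ) (f : L2) :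
    inner ℝ (trigDeriv n f) (dirichlet n) = inner ℝ f (dirichletOne n) := by
  have hpi := Real.pi_ne_zero
  rw [trigDeriv, dirichlet, dirichletOne, inner_trigPoly_trigPoly, inner_trigPoly_right,
    Finset.mul_sum]
  simp only [Pi.zero_apply]
  rw [zero_mul, zero_mul, mul_zero]
  congr 1
  refine Finset.sum_congr rfl fun k _ => ?_
  field_simp
  ring

theorem norm_sq_dirichlet (n : ℕ) : ‖dirichlet n‖ ^ 2 = 2 * Real.pi * (2 * n + 1) := by
  rw [dirichlet, norm_sq_trigPoly]
  simp
  ring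

theorem norm_dirichletOne_le (n : ℕ) : ‖dirichletOne n‖ ≤ n * ‖dirichlet n‖ := by
  refine le_of_sq_le_sq ?_ (by positivity)
  rw [mul_pow, dirichletOne, dirichlet, norm_sq_trigPoly, norm_sq_trigPoly]
  have hpi := Real.pi_pos
  have : ∑ k ∈ Finset.Icc 1 n, ((0 : ℕ → ℝ) k ^ 2 + (2 * (k : ℝ)) ^ 2) ≤
      n ^ 2 * ∑ k ∈ Finset.Icc 1 n, ((2 : ℝ) ^ 2 + (0 : ℕ → ℝ) k ^ 2) := by
    rw [Finset.mul_sum]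
    refine Finset.sum_le_sum fun k hk => ?_
    have hk' : (k : ℝ) ≤ n := by exact_mod_cast (Finset.mem_Icc.1 hk).2
    have : (k : ℝ) ^ 2 ≤ n ^ 2 := by gcongr
    simp only [Pi.zero_apply]
    nlinarith
  have h2 := mul_le_mul_of_nonneg_left this Real.pi_pos.le
  have : 0 ≤ (n : ℝ) ^ 2 * (2 * Real.pi) := by positivity
  linarith

theorem norm_dirichletTwo_le (n : ℕ) : ‖dirichletTwo n‖ ≤ n ^ 2 * ‖dirichlet n‖ := by
  refine le_of_sq_le_sq ?_ (by positivity)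
  rw [mul_pow, dirichletTwo, dirichlet, norm_sq_trigPoly, norm_sq_trigPoly]
  have hpi := Real.pi_pos
  have : ∑ k ∈ Finset.Icc 1 n, ((2 * (k : ℝ) ^ 2) ^ 2 + (0 : ℕ → ℝ) k ^ 2) ≤
      (n ^ 2) ^ 2 * ∑ k ∈ Finset.Icc 1 n, ((2 : ℝ) ^ 2 + (0 : ℕ → ℝ) k ^ 2) := by
    rw [Finset.mul_sum]
    refine Finset.sum_le_sum fun k hk => ?_
    have hk' : (k : ℝ) ≤ n := by exact_mod_cast (Finset.mem_Icc.1 hk).2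
    have : ((k : ℝ) ^ 2) ^ 2 ≤ ((n : ℝ) ^ 2) ^ 2 := by gcongr
    simp only [Pi.zero_apply]
    nlinarith
  have h2 := mul_le_mul_of_nonneg_left this Real.pi_pos.le
  have : 0 ≤ ((n : ℝ) ^ 2) ^ 2 * (2 * Real.pi) := by positivity
  linarith

theorem abs_inner_trigPoly_le (f : L2) (n : ℕ) (m : ℝ) (α β : ℕ → ℝ) :
    |inner ℝ f (trigPoly n m α β)| ≤ ‖proj n f‖ * ‖trigPoly n m α β‖ := by
  rw [← inner_proj_right f (trigPoly_mem_trigSpace n m α β)]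
  exact abs_real_inner_le_norm _ _

theorem abs_inner_le_of_orthogonal (f : L2) {n : ℕ} {h : L2} (hh : h ∈ (trigSpace n)ᗮ) :
    |inner ℝ f h| ≤ ‖f - proj n f‖ * ‖h‖ := by
  rw [real_inner_comm, ← inner_sub_proj f hh, mul_comm]
  exact abs_real_inner_le_norm _ _

theorem norm_dirichlet_mul_norm_sawtoothTail_le (n : ℕ) :
    ‖dirichlet n‖ * ‖sawtoothTail n‖ ≤ 4 * Real.pi := by
  have hpi := Real.pi_pos
  refine le_of_sq_le_sq ?_ (by positivity)
  rw [mul_pow, norm_sq_dirichlet]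
  calc _ ≤ 2 * Real.pi * (2 * n + 1) * (8 * Real.pi / (2 * n + 1)) :=
        mul_le_mul_of_nonneg_left (norm_sq_sawtoothTail_le n) (by positivity)
    _ = _ := by field_simp; ring

/-! ### The stability estimate -/

/-- Cramer's rule for the 2 × 2 system with diagonal π; the determinant π² - st stays away from zero
because st ≤ 4. -/
theorem abs_add_abs_le_of_tridiagonal {w₀ w₁ s t f₀ f₁ Y : ℝ} (hs0 : 0 ≤ s) (hs : s ≤ 2)
    (ht0 : 0 ≤ t) (ht : t ≤ 3) (hst : s * t ≤ 4) (h0 : Real.pi * w₀ - s * w₁ = f₀)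
    (h1 : Real.pi * w₁ - t * w₀ = f₁) (hf0 : |f₀| ≤ Y) (hf1 : |f₁| ≤ Y) :
    |w₀| + |w₁| ≤ 2 * Y := by
  have hp := Real.pi_gt_d2
  have hp' := Real.pi_lt_d2
  have hY : 0 ≤ Y := (abs_nonneg _).trans hf0
  -- From π > 3.14, π² > 9.8596.
  have hdet : 5.85 ≤ Real.pi ^ 2 - s * t := by nlinarith
  have key : ∀ w g : ℝ, ∀ b : ℝ, (Real.pi ^ 2 - s * t) * w = g → |g| ≤ b → 5.85 * |w| ≤ b := by
    intro w g b hw hg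
    rw [← hw, abs_mul, abs_of_nonneg (by linarith : 0 ≤ Real.pi ^ 2 - s * t)] at hg
    exact (mul_le_mul_of_nonneg_right hdet (abs_nonneg w)).trans hg
  have k0 := key w₀ (Real.pi * f₀ + s * f₁) (3.15 * Y + 2 * Y) (by rw [← h0, ← h1]; ring)
    ((abs_add_le _ _).trans (by
      rw [abs_mul, abs_mul, abs_of_nonneg hs0, abs_of_pos Real.pi_pos]
      gcongr))
  have k1 := key w₁ (Real.pi * f₁ + t * f₀) (3.15 * Y + 3 * Y) (by rw [← h0, ← h1]; ring)
    ((abs_add_le _ _).trans (by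
      rw [abs_mul, abs_mul, abs_of_nonneg ht0, abs_of_pos Real.pi_pos]
      gcongr))
  linarith

/-- Eliminating the outer unknowns leaves w₁ with coefficient π² - 2st, still at least 1.85; the
outer two then follow from their own equations. -/
theorem abs_add_abs_add_abs_le_of_tridiagonal {w₀ w₁ w₂ s t f₀ f₁ f₂ Y : ℝ} (hs0 : 0 ≤ s)
    (hs : s ≤ 2) (ht0 : 0 ≤ t) (ht : t ≤ 3) (hst : s * t ≤ 4) (h0 : Real.pi * w₀ - s * w₁ = f₀)
    (h1 : Real.pi * w₁ - s * w₂ - t * w₀ = f₁) (h2 : Real.pi * w₂ - t * w₁ = f₂)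
    (hf0 : |f₀| ≤ Y) (hf1 : |f₁| ≤ Y) (hf2 : |f₂| ≤ Y) :
    |w₀| + |w₁| + |w₂| ≤ 13 * Y := by
  have hp := Real.pi_gt_d2
  have hp' := Real.pi_lt_d2
  have hY : 0 ≤ Y := (abs_nonneg _).trans hf0
  have hdet : 1.85 ≤ Real.pi ^ 2 - 2 * (s * t) := by nlinarith
  have k1 : 1.85 * |w₁| ≤ 3.15 * Y + 3 * Y + 2 * Y := by
    have e : (Real.pi ^ 2 - 2 * (s * t)) * w₁ = Real.pi * f₁ + t * f₀ + s * f₂ := by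
      rw [← h0, ← h1, ← h2]; ring
    have b : |Real.pi * f₁ + t * f₀ + s * f₂| ≤ 3.15 * Y + 3 * Y + 2 * Y := by
      refine (abs_add_three _ _ _).trans ?_
      rw [abs_mul, abs_mul, abs_mul, abs_of_nonneg hs0, abs_of_nonneg ht0, abs_of_pos Real.pi_pos]
      gcongr
    rw [← e, abs_mul, abs_of_nonneg (by linarith : 0 ≤ Real.pi ^ 2 - 2 * (s * t))] at b
    exact (mul_le_mul_of_nonneg_right hdet (abs_nonneg _)).trans b
  have key : ∀ w f r c : ℝ, 0 ≤ r → r ≤ c → |f| ≤ Y → Real.pi * w - r * w₁ = f →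
      3.14 * |w| ≤ Y + c * |w₁| := by
    intro w f r c hr hrc hf hw
    have b : |Real.pi * w| ≤ Y + c * |w₁| := by
      rw [show Real.pi * w = f + r * w₁ by linarith]
      refine (abs_add_le _ _).trans ?_
      rw [abs_mul, abs_of_nonneg hr]
      gcongr
    rw [abs_mul, abs_of_pos Real.pi_pos] at b
    exact (mul_le_mul_of_nonneg_right hp.le (abs_nonneg _)).trans b
  have k0 := key w₀ f₀ s 2 hs0 hs hf0 h0
  have k2 := key w₂ f₂ t 3 ht0 ht hf2 h2
  linarith

/-- One step of a recursion: applied to v, Av, … it reduces the stability estimate to bounding the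
weighted means of the intermediate primitives. -/
theorem norm_proj_le (n : ℕ) (f : L2) :
    ‖proj n f‖ ≤ n * ‖proj n (opA 1 f)‖ +
      |‖dirichlet n‖ / (2 * Real.pi) * inner ℝ f (cosL2 0)| := by
  rw [proj_eq_trigDeriv_add]
  refine (norm_add_le _ _).trans (add_le_add (norm_trigDeriv_le _ _) (le_of_eq ?_))
  rw [norm_smul, Real.norm_eq_abs, abs_mul, abs_div, abs_div, abs_of_nonneg (norm_nonneg _)]
  ring

/-- Brings all the right-hand sides of the system to one size, as q + i + 1 = p in each use. The 3
comes from ‖D_n‖²/(2π) = 2n + 1 ≤ 3n, and the 2 from ‖D_n‖ ‖R_n‖ ≤ 4π. -/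
theorem abs_weighted_le {n q i : ℕ} (hn : 1 ≤ n) {F B W c : ℝ} (hB : 0 ≤ B) (hW : 0 ≤ W)
    (hF : |F| ≤ B * ((n : ℝ) ^ i * ‖dirichlet n‖) + W * c)
    (hc : (n : ℝ) ^ q * c ≤ ‖sawtoothTail n‖) :
    |(n : ℝ) ^ q * (‖dirichlet n‖ / (2 * Real.pi)) * F| ≤
      3 * (n : ℝ) ^ (q + i + 1) * B + 2 * W := by
  have hpi := Real.pi_pos
  have hn1 : (1 : ℝ) ≤ n := by exact_mod_cast hn
  have hd := norm_sq_dirichlet n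
  have hr := norm_dirichlet_mul_norm_sawtoothTail_le n
  have hd0 := norm_nonneg (dirichlet n)
  set d := ‖dirichlet n‖
  rw [abs_mul, abs_of_nonneg (by positivity)]
  calc (n : ℝ) ^ q * (d / (2 * Real.pi)) * |F|
      ≤ (n : ℝ) ^ q * (d / (2 * Real.pi)) * (B * ((n : ℝ) ^ i * d) + W * c) := by gcongr
    _ = (n : ℝ) ^ (q + i) * (d ^ 2 / (2 * Real.pi)) * B +
        W * (d * ((n : ℝ) ^ q * c)) / (2 * Real.pi) := by ring
    _ ≤ (n : ℝ) ^ (q + i) * (3 * n) * B + W * (4 * Real.pi) / (2 * Real.pi) := by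
        gcongr _ * ?_ * _ + _ * ?_ / _
        · rw [hd, mul_div_cancel_left₀ _ (by positivity)]
          linarith
        · exact (mul_le_mul_of_nonneg_left hc hd0).trans hr
    _ = _ := by field_simp; ring

/-- The squared norm of the tail of the sawtooth function, suitably normalised. -/
def tailConst (n : ℕ) : ℝ := ‖sawtoothTail n‖ ^ 2 / (2 * Real.pi)

theorem tailConst_nonneg (n : ℕ) : 0 ≤ tailConst n := by
  have := Real.pi_pos
  unfold tailConst
  positivity

theorem tailConst_mul_le (n : ℕ) : tailConst n * (2 * n + 1) ≤ 4 := by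
  have hpi := Real.pi_pos
  unfold tailConst
  calc _ ≤ 8 * Real.pi / (2 * n + 1) / (2 * Real.pi) * (2 * n + 1) := by
        gcongr
        exact norm_sq_sawtoothTail_le n
    _ = 4 := by field_simp; norm_num

theorem norm_meanFreePrimitive_sawtoothTail_le (n : ℕ) :
    (n : ℝ) ^ 1 * ‖meanFreePrimitive (sawtoothTail n)‖ ≤ ‖sawtoothTail n‖ := by
  rw [pow_one]
  exact norm_meanFreePrimitive_le (sawtoothTail_mem n)

theorem norm_meanFreePrimitive_meanFreePrimitive_sawtoothTail_le (n : ℕ) :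
    (n : ℝ) ^ 2 * ‖meanFreePrimitive (meanFreePrimitive (sawtoothTail n))‖ ≤
      ‖sawtoothTail n‖ := by
  have h1 := norm_meanFreePrimitive_le (meanFreePrimitive_mem (sawtoothTail_mem n))
  have h2 := norm_meanFreePrimitive_le (sawtoothTail_mem n)
  have h3 := mul_le_mul_of_nonneg_left h1 (Nat.cast_nonneg n : (0 : ℝ) ≤ n)
  linarith

theorem norm_proj_le_of_opA_two {n : ℕ} (hn : 1 ≤ n) (v : L2) :
    ‖proj n v‖ ≤ 7 * (n : ℝ) ^ 2 * ‖proj n (opA 2 v)‖ + 4 * ‖v - proj n v‖ := by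
  rw [opA_two]
  have hpi := Real.pi_pos
  have hn1 : (1 : ℝ) ≤ n := by exact_mod_cast hn
  set g := opA 1 v with hg
  set u := opA 1 g with hu
  set x₁ : ℝ := inner ℝ v (cosL2 0) with hx1
  set x₀ : ℝ := inner ℝ g (cosL2 0) with hx0
  set R := sawtoothTail n with hR
  have e0 : inner ℝ u (dirichlet n) = Real.pi * x₀ - inner ℝ v (meanFreePrimitive R) -
      tailConst n * x₁ := by
    rw [hu, inner_opA_one_dirichlet, hg, inner_opA_one_sawtoothTail, tailConst]; ring
  have e1 : inner ℝ u (dirichletOne n) = Real.pi * x₁ + inner ℝ v R - (2 * n + 1) * x₀ := by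
    rw [hu, inner_opA_one_dirichletOne, hg, inner_opA_one_dirichlet]
  have hs0 := tailConst_nonneg n
  have hst := tailConst_mul_le n
  set d := ‖dirichlet n‖ with hd
  set B := ‖proj n u‖ with hB
  set W := ‖v - proj n v‖ with hW
  set F₀ : ℝ := inner ℝ u (dirichlet n) + inner ℝ v (meanFreePrimitive R) with hF0
  set F₁ : ℝ := inner ℝ u (dirichletOne n) - inner ℝ v R with hF1
  have b0 : |F₀| ≤ B * ((n : ℝ) ^ 0 * d) + W * ‖meanFreePrimitive R‖ := by
    rw [pow_zero, one_mul]
    exact (abs_add_le _ _).trans (add_le_add (abs_inner_trigPoly_le u n _ _ _)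
      (abs_inner_le_of_orthogonal v (meanFreePrimitive_mem (sawtoothTail_mem n))))
  have b1 : |F₁| ≤ B * ((n : ℝ) ^ 1 * d) + W * ‖R‖ := by
    rw [pow_one]
    exact (abs_sub _ _).trans (add_le_add ((abs_inner_trigPoly_le u n _ _ _).trans
      (mul_le_mul_of_nonneg_left (norm_dirichletOne_le n) (norm_nonneg _)))
      (abs_inner_le_of_orthogonal v (sawtoothTail_mem n)))
  have c0 := abs_weighted_le (q := 1) hn (norm_nonneg _) (norm_nonneg _) b0
    (norm_meanFreePrimitive_sawtoothTail_le n)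
  have c1 := abs_weighted_le (q := 0) hn (norm_nonneg _) (norm_nonneg _) b1
    (by rw [pow_zero, one_mul])
  -- The extra weight n on the outer mean balances the matrix: the entries `tailConst n` (of order
  -- 1/n) and 2n + 1 both become bounded, while their product is unchanged.
  have h := abs_add_abs_le_of_tridiagonal (w₀ := n * (d / (2 * Real.pi) * x₀))
    (w₁ := d / (2 * Real.pi) * x₁) (s := n * tailConst n) (t := (2 * n + 1) / n)
    (by positivity) (by nlinarith) (by positivity)
    (by rw [div_le_iff₀ (by positivity)]; linarith) (le_of_eq_of_le (by field_simp) hst)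
    (by rw [hF0, e0]; ring) (by rw [hF1, e1]; field_simp; ring) c0 c1
  -- With Y = 3n²B + 2W, the recursion gives n²B + 2Y = 7n²B + 4W.
  have p1 := norm_proj_le n v
  have p0 := mul_le_mul_of_nonneg_left (norm_proj_le n g) (Nat.cast_nonneg n : (0 : ℝ) ≤ n)
  rw [abs_mul (n : ℝ), Nat.abs_cast] at h
  simp only [Nat.reduceAdd] at h
  linarith

theorem norm_proj_le_of_opA_three {n : ℕ} (hn : 1 ≤ n) (v : L2) :
    ‖proj n v‖ ≤ 40 * (n : ℝ) ^ 3 * ‖proj n (opA 3 v)‖ + 26 * ‖v - proj n v‖ := by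
  rw [opA_three]
  have hpi := Real.pi_pos
  have hn1 : (1 : ℝ) ≤ n := by exact_mod_cast hn
  set g := opA 1 v with hg
  set k := opA 1 g with hk
  set u := opA 1 k with hu
  set x₂ : ℝ := inner ℝ v (cosL2 0) with hx2
  set x₁ : ℝ := inner ℝ g (cosL2 0) with hx1
  set x₀ : ℝ := inner ℝ k (cosL2 0) with hx0
  set R := sawtoothTail n with hR
  have e0 : inner ℝ u (dirichlet n) = Real.pi * x₀ - tailConst n * x₁ +
      inner ℝ v (meanFreePrimitive (meanFreePrimitive R)) := by
    rw [hu, inner_opA_one_dirichlet, hk, inner_opA_one_sawtoothTail, hg,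
      inner_opA_one_meanFreePrimitive_sawtoothTail, tailConst]; ring
  have e1 : inner ℝ u (dirichletOne n) = Real.pi * x₁ - tailConst n * x₂ -
      inner ℝ v (meanFreePrimitive R) - (2 * n + 1) * x₀ := by
    rw [hu, inner_opA_one_dirichletOne, hk, inner_opA_one_dirichlet, hg,
      inner_opA_one_sawtoothTail, tailConst]; ring
  have e2 : inner ℝ u (dirichletTwo n) = -(Real.pi * x₂ + inner ℝ v R - (2 * n + 1) * x₁) := by
    rw [hu, inner_opA_one_dirichletTwo, hk, inner_opA_one_dirichletOne, hg,
      inner_opA_one_dirichlet]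
  have hs0 := tailConst_nonneg n
  have hst := tailConst_mul_le n
  set d := ‖dirichlet n‖ with hd
  set B := ‖proj n u‖ with hB
  set W := ‖v - proj n v‖ with hW
  set F₀ : ℝ := inner ℝ u (dirichlet n) - inner ℝ v (meanFreePrimitive (meanFreePrimitive R))
    with hF0
  set F₁ : ℝ := inner ℝ u (dirichletOne n) + inner ℝ v (meanFreePrimitive R) with hF1
  set F₂ : ℝ := -inner ℝ u (dirichletTwo n) - inner ℝ v R with hF2
  have b0 : |F₀| ≤ B * ((n : ℝ) ^ 0 * d) + W * ‖meanFreePrimitive (meanFreePrimitive R)‖ := by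
    rw [pow_zero, one_mul]
    exact (abs_sub _ _).trans (add_le_add (abs_inner_trigPoly_le u n _ _ _)
      (abs_inner_le_of_orthogonal v
        (meanFreePrimitive_mem (meanFreePrimitive_mem (sawtoothTail_mem n)))))
  have b1 : |F₁| ≤ B * ((n : ℝ) ^ 1 * d) + W * ‖meanFreePrimitive R‖ := by
    rw [pow_one]
    exact (abs_add_le _ _).trans (add_le_add ((abs_inner_trigPoly_le u n _ _ _).trans
      (mul_le_mul_of_nonneg_left (norm_dirichletOne_le n) (norm_nonneg _)))
      (abs_inner_le_of_orthogonal v (meanFreePrimitive_mem (sawtoothTail_mem n))))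
  have b2 : |F₂| ≤ B * ((n : ℝ) ^ 2 * d) + W * ‖R‖ := by
    refine (abs_sub _ _).trans ?_
    rw [abs_neg]
    exact add_le_add ((abs_inner_trigPoly_le u n _ _ _).trans
      (mul_le_mul_of_nonneg_left (norm_dirichletTwo_le n) (norm_nonneg _)))
      (abs_inner_le_of_orthogonal v (sawtoothTail_mem n))
  have c0 := abs_weighted_le (q := 2) hn (norm_nonneg _) (norm_nonneg _) b0
    (norm_meanFreePrimitive_meanFreePrimitive_sawtoothTail_le n)
  have c1 := abs_weighted_le (q := 1) hn (norm_nonneg _) (norm_nonneg _) b1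
    (norm_meanFreePrimitive_sawtoothTail_le n)
  have c2 := abs_weighted_le (q := 0) hn (norm_nonneg _) (norm_nonneg _) b2
    (by rw [pow_zero, one_mul])
  have h := abs_add_abs_add_abs_le_of_tridiagonal (w₀ := (n : ℝ) ^ 2 * (d / (2 * Real.pi) * x₀))
    (w₁ := n * (d / (2 * Real.pi) * x₁)) (w₂ := d / (2 * Real.pi) * x₂)
    (s := n * tailConst n) (t := (2 * n + 1) / n)
    (by positivity) (by nlinarith) (by positivity)
    (by rw [div_le_iff₀ (by positivity)]; linarith) (le_of_eq_of_le (by field_simp) hst)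
    (by rw [hF0, e0]; ring) (by rw [hF1, e1]; field_simp; ring)
    (by rw [hF2, e2]; field_simp; ring) c0 c1 c2
  -- With Y = 3n³B + 2W, the recursion gives n³B + 13Y = 40n³B + 26W.
  have p2 := norm_proj_le n v
  have p1 := mul_le_mul_of_nonneg_left (norm_proj_le n g) (Nat.cast_nonneg n : (0 : ℝ) ≤ n)
  have p0 := mul_le_mul_of_nonneg_left (norm_proj_le n k) (by positivity : (0 : ℝ) ≤ (n : ℝ) ^ 2)
  rw [abs_mul (n : ℝ), abs_mul ((n : ℝ) ^ 2), abs_pow, Nat.abs_cast] at h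
  simp only [Nat.reduceAdd] at h
  have hW0 : 0 ≤ (n : ℝ) ^ 3 * B := by positivity
  linarith

/-- Cauchy-Schwarz against ‖y‖x + ‖x‖y. Orthogonality gains a factor 2 over bounding each pairing
separately; without it the argument for p = 1 would not reach √3. -/
theorem two_mul_inner_mul_inner_le {b x y : L2} (hxy : inner ℝ x y = 0) :
    2 * (inner ℝ b x * inner ℝ b y) ≤ ‖x‖ * ‖y‖ * ‖b‖ ^ 2 := by
  rcases eq_or_ne x 0 with rfl | hx
  · simp
  rcases eq_or_ne y 0 with rfl | hy
  · simp
  have hx' := norm_pos_iff.2 hx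
  have hy' := norm_pos_iff.2 hy
  have h1 : inner ℝ b (‖y‖ • x + ‖x‖ • y) ^ 2 ≤ ‖b‖ ^ 2 * ‖‖y‖ • x + ‖x‖ • y‖ ^ 2 := by
    rw [← mul_pow]
    exact sq_le_sq' (neg_le_of_abs_le (abs_real_inner_le_norm _ _)) (real_inner_le_norm _ _)
  have h2 : ‖‖y‖ • x + ‖x‖ • y‖ ^ 2 = 2 * (‖x‖ * ‖y‖) ^ 2 := by
    rw [@norm_add_sq_real, inner_smul_left, inner_smul_right, hxy, norm_smul, norm_smul]
    simp
    ring
  rw [h2, inner_add_right, inner_smul_right, inner_smul_right] at h1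
  set p : ℝ := inner ℝ b x
  set q : ℝ := inner ℝ b y
  have h3 : (‖x‖ * ‖y‖) * (2 * (p * q)) ≤ (‖x‖ * ‖y‖) * (‖x‖ * ‖y‖ * ‖b‖ ^ 2) := by
    nlinarith [sq_nonneg (‖y‖ * p - ‖x‖ * q)]
  exact le_of_mul_le_mul_left h3 (by positivity)

theorem inner_dirichlet_dirichletOne (n : ℕ) :
    inner ℝ (dirichlet n) (dirichletOne n) = 0 := by
  simp [dirichlet, dirichletOne, inner_trigPoly_trigPoly]

theorem norm_proj_le_of_opA_one {n : ℕ} (hn : 1 ≤ n) (v : L2) :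
    ‖proj n v‖ ≤ Real.sqrt 3 * n * ‖proj n (opA 1 v)‖ + ‖v - proj n v‖ := by
  have hpi := Real.pi_pos
  have hp := Real.pi_gt_d2
  have hn1 : (1 : ℝ) ≤ n := by exact_mod_cast hn
  set u := opA 1 v with hu
  have e := inner_opA_one_dirichlet n v
  rw [← hu] at e
  set a : ℝ := inner ℝ u (dirichlet n) with ha
  set c : ℝ := inner ℝ v (sawtoothTail n) with hc
  have hd := norm_sq_dirichlet n
  have hr := norm_dirichlet_mul_norm_sawtoothTail_le n
  -- The mean of v is (a - c)/π: the part with a is controlled by P_n Av, the part with c by the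
  -- tail of v.
  have hsplit : proj n v = (trigDeriv n u + (a / (2 * Real.pi ^ 2)) • dirichlet n) -
      (c / (2 * Real.pi ^ 2)) • dirichlet n := by
    rw [proj_eq_trigDeriv_add, ← hu, add_sub_assoc, ← sub_smul,
      show (inner ℝ v (cosL2 0) : ℝ) = (a - c) / Real.pi by rw [e]; field_simp; ring]
    congr 2
    field_simp
  have hsecond : ‖(c / (2 * Real.pi ^ 2)) • dirichlet n‖ ≤ ‖v - proj n v‖ := by
    have hcW : |c| ≤ ‖v - proj n v‖ * ‖sawtoothTail n‖ :=
      abs_inner_le_of_orthogonal v (sawtoothTail_mem n)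
    rw [norm_smul, Real.norm_eq_abs, abs_div, abs_of_pos (by positivity : 0 < 2 * Real.pi ^ 2),
      div_mul_eq_mul_div, div_le_iff₀ (by positivity)]
    calc |c| * ‖dirichlet n‖ ≤ ‖v - proj n v‖ * ‖sawtoothTail n‖ * ‖dirichlet n‖ := by gcongr
      _ = ‖v - proj n v‖ * (‖dirichlet n‖ * ‖sawtoothTail n‖) := by ring
      _ ≤ ‖v - proj n v‖ * (2 * Real.pi ^ 2) :=
          mul_le_mul_of_nonneg_left (by nlinarith) (norm_nonneg _)
  have hfirst : ‖trigDeriv n u + (a / (2 * Real.pi ^ 2)) • dirichlet n‖ ≤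
      Real.sqrt 3 * n * ‖proj n u‖ := by
    refine le_of_sq_le_sq ?_ (by positivity)
    rw [mul_pow, mul_pow, Real.sq_sqrt (by norm_num), @norm_add_sq_real, inner_smul_right,
      inner_trigDeriv_dirichlet, norm_smul, mul_pow, Real.norm_eq_abs, sq_abs, hd]
    have h1 := norm_trigDeriv_le n u
    have h1' : ‖trigDeriv n u‖ ^ 2 ≤ (n * ‖proj n u‖) ^ 2 := by gcongr
    have h2 := two_mul_inner_mul_inner_le (b := proj n u) (inner_dirichlet_dirichletOne n)
    have m1 : inner ℝ (proj n u) (dirichletOne n) = inner ℝ u (dirichletOne n) :=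
      inner_proj_right u (trigPoly_mem_trigSpace n _ _ _)
    have m0 : inner ℝ (proj n u) (dirichlet n) = a :=
      inner_proj_right u (trigPoly_mem_trigSpace n _ _ _)
    rw [m1, m0] at h2
    have h3 : a ^ 2 ≤ ‖proj n u‖ ^ 2 * ‖dirichlet n‖ ^ 2 := by
      rw [← mul_pow, ← m0]
      exact sq_le_sq' (neg_le_of_abs_le (abs_real_inner_le_norm _ _)) (real_inner_le_norm _ _)
    set B := ‖proj n u‖
    have h4 : ‖dirichlet n‖ * ‖dirichletOne n‖ * B ^ 2 ≤ 2 * Real.pi * (3 * n) * n * B ^ 2 := by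
      refine mul_le_mul_of_nonneg_right ?_ (sq_nonneg B)
      calc ‖dirichlet n‖ * ‖dirichletOne n‖ ≤ ‖dirichlet n‖ * (n * ‖dirichlet n‖) := by
            gcongr
            exact norm_dirichletOne_le n
        _ = ‖dirichlet n‖ ^ 2 * n := by ring
        _ ≤ 2 * Real.pi * (3 * n) * n := by
            rw [hd]
            gcongr
            linarith
    have h5 : a ^ 2 ≤ B ^ 2 * (2 * Real.pi * (3 * n)) := by
      refine h3.trans ?_
      rw [hd]
      gcongr
      linarith
    set y : ℝ := inner ℝ u (dirichletOne n)
    have t1 : 2 * (a / (2 * Real.pi ^ 2) * y) ≤ 3 / Real.pi * (n * B) ^ 2 := by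
      calc 2 * (a / (2 * Real.pi ^ 2) * y) = 2 * (a * y) / (2 * Real.pi ^ 2) := by ring
        _ ≤ (2 * Real.pi * (3 * n) * n * B ^ 2) / (2 * Real.pi ^ 2) := by
            exact div_le_div_of_nonneg_right (h2.trans h4) (by positivity)
        _ = _ := by field_simp
    have t2 : (a / (2 * Real.pi ^ 2)) ^ 2 * (2 * Real.pi * (2 * n + 1)) ≤
        9 / Real.pi ^ 2 * (n * B) ^ 2 := by
      calc (a / (2 * Real.pi ^ 2)) ^ 2 * (2 * Real.pi * (2 * n + 1))
          ≤ (a / (2 * Real.pi ^ 2)) ^ 2 * (2 * Real.pi * (3 * n)) := by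
            gcongr
            linarith
        _ = a ^ 2 * (2 * Real.pi * (3 * n)) / (4 * Real.pi ^ 4) := by field_simp; ring
        _ ≤ (B ^ 2 * (2 * Real.pi * (3 * n))) * (2 * Real.pi * (3 * n)) / (4 * Real.pi ^ 4) := by
            gcongr
        _ = _ := by field_simp; ring
    -- Together with the 1 from Bernstein's inequality, the cross term and the square of the kernel
    -- term add up to at most 3, whence √3.
    have t3 : 3 / Real.pi + 9 / Real.pi ^ 2 ≤ 2 := by
      rw [div_add_div _ _ (by positivity) (by positivity), div_le_iff₀ (by positivity)]
      nlinarith [pow_pos hpi 2, pow_pos hpi 3]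
    have t4 := mul_le_mul_of_nonneg_right t3 (sq_nonneg ((n : ℝ) * B))
    nlinarith
  -- The goal contains the projection in the tail as well, so the bounds have to be rewritten along
  -- with it.
  rw [hsplit] at *
  exact (norm_sub_le _ _).trans (add_le_add hfirst hsecond)

theorem le_one_add_sqrt {a b : ℝ} (h : a ^ 2 ≤ b) : a ≤ 1 + Real.sqrt b := by
  linarith [Real.le_sqrt_of_sq_le h]

/-- The high-frequency part of `v` and the projected primitive control the projection of `v`. -/
theorem norm_proj_le_of_opA {p n : ℕ} (hp1 : 1 ≤ p) (hp3 : p ≤ 3) (hn : 1 ≤ n) (v : L2) :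
    ‖proj n v‖ ≤ constC p * (n : ℝ) ^ p * ‖proj n (opA p v)‖ +
      constGamma p * ‖v - proj n v‖ := by
  have hW := norm_nonneg (v - proj n v)
  interval_cases p
  · refine (norm_proj_le_of_opA_one hn v).trans ?_
    rw [pow_one]
    refine add_le_add le_rfl (le_mul_of_one_le_left hW ?_)
    simp [constGamma, constKappa, Real.sqrt_nonneg]
  · refine (norm_proj_le_of_opA_two hn v).trans ?_
    have hg : 4 ≤ constGamma 2 := by
      unfold constGamma constKappa
      refine le_one_add_sqrt ?_
      linarith [sq_nonneg (Real.sqrt 2), sq_nonneg Real.pi, sq_nonneg (3 * Real.sqrt 2 / 2)]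
    unfold constC
    gcongr
    norm_num
  · refine (norm_proj_le_of_opA_three hn v).trans ?_
    have hg : 26 ≤ constGamma 3 := by
      unfold constGamma constKappa
      refine le_one_add_sqrt ?_
      linarith [sq_nonneg (11 * Real.sqrt 2), sq_nonneg (11 * Real.pi),
        sq_nonneg (44 * Real.sqrt 2 / 3)]
    unfold constC
    gcongr
    norm_num

/-! ### Functions with vanishing initial values are iterated integrals of their weak derivative -/

/-- The test functions on `(0, 2π)`. -/
structure IsTest (φ : ℝ → ℝ) : Prop where
  contDiff : ContDiff ℝ ∞ φ
  hasCompactSupport : HasCompactSupport φ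
  tsupport_subset : tsupport φ ⊆ Ioo 0 (2 * Real.pi)

theorem IsTest.apply_zero {φ : ℝ → ℝ} (h : IsTest φ) : φ 0 = 0 :=
  image_eq_zero_of_notMem_tsupport fun h0 => lt_irrefl _ (h.tsupport_subset h0).1

theorem IsTest.apply_two_pi {φ : ℝ → ℝ} (h : IsTest φ) : φ (2 * Real.pi) = 0 :=
  image_eq_zero_of_notMem_tsupport fun h0 => lt_irrefl _ (h.tsupport_subset h0).2

theorem IsTest.deriv {φ : ℝ → ℝ} (h : IsTest φ) : IsTest (deriv φ) :=
  ⟨(contDiff_infty_iff_deriv.1 h.contDiff).2, h.hasCompactSupport.deriv,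
    tsupport_deriv_subset.trans h.tsupport_subset⟩

theorem IsTest.iteratedDeriv {φ : ℝ → ℝ} (h : IsTest φ) (k : ℕ) : IsTest (iteratedDeriv k φ) := by
  induction k with
  | zero => simpa using h
  | succ k ih => rw [iteratedDeriv_succ]; exact ih.deriv

theorem IsTest.hasDerivAt {φ : ℝ → ℝ} (h : IsTest φ) (x : ℝ) :
    HasDerivAt φ (_root_.deriv φ x) x :=
  ((contDiff_infty_iff_deriv.1 h.contDiff).1 x).hasDerivAt

theorem IsTest.continuous {φ : ℝ → ℝ} (h : IsTest φ) : Continuous φ := h.contDiff.continuous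

/-- A test function with mean value zero is the derivative of a test function. -/
theorem IsTest.exists_deriv_eq {η : ℝ → ℝ} (h : IsTest η)
    (h0 : ∫ x in (0 : ℝ)..(2 * Real.pi), η x = 0) : ∃ φ, IsTest φ ∧ _root_.deriv φ = η := by
  have hder : ∀ x, HasDerivAt (fun x => ∫ t in (0 : ℝ)..x, η t) (η x) x := fun x =>
    (h.continuous.integral_hasStrictDerivAt 0 x).hasDerivAt
  have hderiv : _root_.deriv (fun x => ∫ t in (0 : ℝ)..x, η t) = η := funext fun x => (hder x).deriv
  -- Left of a the primitive is zero trivially, right of b because the total integral vanishes. The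
  -- bounds 1, 0 for empty support give an empty interval.
  obtain ⟨a, b, ha, hb, hab⟩ : ∃ a b : ℝ, 0 < a ∧ b < 2 * Real.pi ∧ tsupport η ⊆ Icc a b := by
    have hK : IsCompact (tsupport η) := h.hasCompactSupport
    rcases (tsupport η).eq_empty_or_nonempty with he | hne
    · exact ⟨1, 0, one_pos, Real.two_pi_pos, by simp [he]⟩
    · exact ⟨sInf (tsupport η), sSup (tsupport η), (h.tsupport_subset (hK.sInf_mem hne)).1,
        (h.tsupport_subset (hK.sSup_mem hne)).2,
        fun x hx => ⟨csInf_le hK.bddBelow hx, le_csSup hK.bddAbove hx⟩⟩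
  have hout : ∀ x, x ∉ Icc a b → η x = 0 := fun x hx =>
    image_eq_zero_of_notMem_tsupport fun hx' => hx (hab hx')
  have hsub : tsupport (fun x => ∫ t in (0 : ℝ)..x, η t) ⊆ Icc a b := by
    refine closure_minimal (fun x hx => ?_) isClosed_Icc
    by_contra hxab
    refine hx ?_
    rcases lt_or_ge x a with hxa | hxa
    · refine intervalIntegral.integral_zero_ae (Filter.Eventually.of_forall fun t ht => ?_)
      have : t ≤ max 0 x := (mem_uIoc.1 ht).elim (fun h => h.2.trans (le_max_right _ _))
        fun h => h.2.trans (le_max_left _ _)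
      exact hout t fun h => absurd (h.1.trans this) (not_le.2 (max_lt ha hxa))
    · have hxb : b < x := not_le.1 fun hxb => hxab ⟨hxa, hxb⟩
      have hadd := intervalIntegral.integral_add_adjacent_intervals
        (h.continuous.intervalIntegrable (μ := volume) 0 x)
        (h.continuous.intervalIntegrable x (2 * Real.pi))
      have hz : ∫ t in x..(2 * Real.pi), η t = 0 := by
        refine intervalIntegral.integral_zero_ae (Filter.Eventually.of_forall fun t ht => ?_)
        have : min x (2 * Real.pi) < t := ht.1
        exact hout t fun h => absurd h.2 (not_le.2 ((lt_min hxb hb).trans this))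
      change ∫ t in (0 : ℝ)..x, η t = 0
      linarith
  refine ⟨fun x => ∫ t in (0 : ℝ)..x, η t, ⟨?_, ?_, ?_⟩, hderiv⟩
  · rw [contDiff_infty_iff_deriv, hderiv]
    exact ⟨fun x => (hder x).differentiableAt, h.contDiff⟩
  · exact HasCompactSupport.of_support_subset_isCompact isCompact_Icc
      ((subset_tsupport _).trans hsub)
  · exact hsub.trans fun x hx => ⟨ha.trans_le hx.1, hx.2.trans_lt hb⟩

theorem exists_isTest_integral_eq_one :
    ∃ φ, IsTest φ ∧ ∫ x in (0 : ℝ)..(2 * Real.pi), φ x = 1 := by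
  have hp := Real.pi_gt_three
  let f : ContDiffBump (Real.pi : ℝ) := ⟨1, 2, one_pos, one_lt_two⟩
  have hsupp : tsupport (f.normed volume) ⊆ Ioo 0 (2 * Real.pi) := by
    rw [f.tsupport_normed_eq, Real.closedBall_eq_Icc]
    intro x hx
    have h1 : Real.pi - 2 ≤ x := hx.1
    have h2 : x ≤ Real.pi + 2 := hx.2
    constructor <;> linarith
  refine ⟨f.normed volume, ⟨f.contDiff_normed, f.hasCompactSupport_normed, hsupp⟩, ?_⟩
  rw [← integral_mu_eq, setIntegral_eq_integral_of_forall_compl_eq_zero, f.integral_normed]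
  exact fun x hx => image_eq_zero_of_notMem_tsupport fun h => hx (hsupp h)

/-- The lemma of du Bois-Reymond. -/
theorem eqOn_const_of_integral_mul_deriv_eq_zero {h : ℝ → ℝ}
    (hc : ContinuousOn h (Icc 0 (2 * Real.pi)))
    (hz : ∀ φ, IsTest φ → ∫ x in (0 : ℝ)..(2 * Real.pi), h x * deriv φ x = 0) :
    ∃ C, EqOn h (fun _ => C) (Icc 0 (2 * Real.pi)) := by
  obtain ⟨ψ₀, hψ₀, hint⟩ := exists_isTest_integral_eq_one
  have hu : uIcc 0 (2 * Real.pi) = Icc 0 (2 * Real.pi) := uIcc_of_le two_pi_nonneg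
  have hI : ∀ ψ, IsTest ψ → IntervalIntegrable (fun x => h x * ψ x) volume 0 (2 * Real.pi) :=
    fun ψ hψ => ContinuousOn.intervalIntegrable (by
      rw [hu]; exact hc.mul hψ.continuous.continuousOn)
  refine ⟨∫ x in (0 : ℝ)..(2 * Real.pi), h x * ψ₀ x, ?_⟩
  set C := ∫ x in (0 : ℝ)..(2 * Real.pi), h x * ψ₀ x
  have key : ∀ ψ, IsTest ψ → ∫ x in (0 : ℝ)..(2 * Real.pi), ψ x * (h x - C) = 0 := by
    intro ψ hψ
    set m := ∫ x in (0 : ℝ)..(2 * Real.pi), ψ x with hm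
    -- Subtracting m ψ₀ makes the mean zero, so the difference is an admissible derivative.
    have hη : IsTest (fun x => ψ x - m * ψ₀ x) := by
      refine ⟨hψ.contDiff.sub (contDiff_const.mul hψ₀.contDiff),
        hψ.hasCompactSupport.sub hψ₀.hasCompactSupport.mul_left, ?_⟩
      exact (tsupport_sub _ _).trans (union_subset hψ.tsupport_subset
        ((tsupport_mul_subset_right).trans hψ₀.tsupport_subset))
    obtain ⟨φ, hφ, hφη⟩ := hη.exists_deriv_eq (by
      rw [intervalIntegral.integral_sub (hψ.continuous.intervalIntegrable _ _)
        ((hψ₀.continuous.intervalIntegrable _ _).const_mul _),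
        intervalIntegral.integral_const_mul, hint, ← hm]
      ring)
    have h1 := hz φ hφ
    rw [hφη] at h1
    have h2 : ∀ x, h x * (ψ x - m * ψ₀ x) = h x * ψ x - m * (h x * ψ₀ x) := fun x => by ring
    simp only [h2] at h1
    rw [intervalIntegral.integral_sub (hI ψ hψ) ((hI ψ₀ hψ₀).const_mul _),
      intervalIntegral.integral_const_mul] at h1
    have h3 : ∀ x, ψ x * (h x - C) = h x * ψ x - C * ψ x := fun x => by ring
    simp only [h3]
    rw [intervalIntegral.integral_sub (hI ψ hψ)
      ((hψ.continuous.intervalIntegrable _ _).const_mul _),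
      intervalIntegral.integral_const_mul, ← hm]
    linarith
  have hae := isOpen_Ioo.ae_eq_zero_of_integral_contDiff_smul_eq_zero (μ := volume)
    (U := Ioo 0 (2 * Real.pi)) (f := fun x => h x - C)
    (((hc.sub continuousOn_const).mono Ioo_subset_Icc_self).locallyIntegrableOn measurableSet_Ioo)
    (fun g h1 h2 h3 => by
      rw [← key g ⟨h1, h2, h3⟩, ← integral_mu_eq,
        setIntegral_eq_integral_of_forall_compl_eq_zero]
      · rfl
      · intro x hx
        rw [image_eq_zero_of_notMem_tsupport fun h => hx (h3 h), zero_mul])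
  refine Measure.eqOn_Icc_of_ae_eq volume Real.two_pi_pos.ne ?_ hc continuousOn_const
  rw [← restrict_Ioo_eq_restrict_Icc]
  filter_upwards [(ae_restrict_iff' measurableSet_Ioo).2 hae] with x hx
  linarith

/-- A continuous function vanishing at `0` is the integral of its weak derivative. -/
theorem eqOn_integral_of_weakDeriv {Y : ℝ → ℝ} {ζ : L2}
    (hc : ContinuousOn Y (Icc 0 (2 * Real.pi))) (h0 : Y 0 = 0)
    (hw : ∀ φ, IsTest φ → ∫ x in (0 : ℝ)..(2 * Real.pi), ζ x * φ x =
      -∫ x in (0 : ℝ)..(2 * Real.pi), Y x * deriv φ x) :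
    EqOn Y (fun x => ∫ t in (0 : ℝ)..x, ζ t) (Icc 0 (2 * Real.pi)) := by
  have hu : uIcc 0 (2 * Real.pi) = Icc 0 (2 * Real.pi) := uIcc_of_le two_pi_nonneg
  have hζ := intervalIntegrable_coe ζ
  have hF : ContinuousOn (fun x => ∫ t in (0 : ℝ)..x, ζ t) (Icc 0 (2 * Real.pi)) :=
    hu ▸ (hζ.absolutelyContinuousOnInterval_intervalIntegral (c := 0) left_mem_uIcc).continuousOn
  obtain ⟨C, hC⟩ := eqOn_const_of_integral_mul_deriv_eq_zero (hc.sub hF) (fun φ hφ => by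
    have h1 := integral_primitive_mul hζ (hφ.deriv.continuous.intervalIntegrable 0 (2 * Real.pi))
    have h2 : ∀ x, ∫ t in (0 : ℝ)..x, deriv φ t = φ x := fun x => by
      rw [intervalIntegral.integral_eq_sub_of_hasDerivAt (fun t _ => hφ.hasDerivAt t)
        (hφ.deriv.continuous.intervalIntegrable _ _), hφ.apply_zero, sub_zero]
    simp only [h2, hφ.apply_two_pi, mul_zero] at h1
    have h3 := hw φ hφ
    simp only [Pi.sub_apply, sub_mul]
    rw [intervalIntegral.integral_sub]
    · linarith
    all_goals
      refine ContinuousOn.intervalIntegrable ?_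
      rw [hu]
    · exact hc.mul hφ.deriv.continuous.continuousOn
    · exact hF.mul hφ.deriv.continuous.continuousOn)
  have hC0 : C = 0 := by
    have := hC (left_mem_Icc.2 two_pi_nonneg)
    simp only [Pi.sub_apply, h0, intervalIntegral.integral_same, sub_zero] at this
    exact this.symm
  intro x hx
  have := hC hx
  simp only [Pi.sub_apply, hC0] at this
  linarith

/-- The primitive of a function vanishing at `0`. -/
def primitive (f : ℝ → ℝ) (x : ℝ) : ℝ := ∫ t in (0 : ℝ)..x, f t

/-- Induction on the order: one integration by parts moves a derivative from the test function to Y,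
and the classical derivative of Y satisfies the hypotheses one order lower. Only the last, merely
weak derivative needs du Bois-Reymond. -/
theorem eqOn_iterate_primitive (p : ℕ) (ζ : L2) : ∀ Y : ℝ → ℝ,
    ContDiffOn ℝ p Y (Icc 0 (2 * Real.pi)) →
    (∀ k < p + 1, iteratedDerivWithin k Y (Icc 0 (2 * Real.pi)) 0 = 0) →
    (∀ φ, IsTest φ → ∫ x in (0 : ℝ)..(2 * Real.pi), ζ x * φ x =
      (-1) ^ (p + 1) * ∫ x in (0 : ℝ)..(2 * Real.pi), Y x * iteratedDeriv (p + 1) φ x) →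
    EqOn Y (primitive^[p + 1] ζ) (Icc 0 (2 * Real.pi)) := by
  have hu : uIcc 0 (2 * Real.pi) = Icc 0 (2 * Real.pi) := uIcc_of_le two_pi_nonneg
  have hun : UniqueDiffOn ℝ (Icc 0 (2 * Real.pi)) := uniqueDiffOn_Icc Real.two_pi_pos
  induction p with
  | zero =>
    intro Y hY h0 hw
    refine eqOn_integral_of_weakDeriv hY.continuousOn (by simpa using h0 0 one_pos) ?_
    intro φ hφ
    simpa [iteratedDeriv_one] using hw φ hφ
  | succ p ih =>
    intro Y hY h0 hw
    push_cast at hY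
    obtain ⟨hd, -, hY'⟩ := (contDiffOn_succ_iff_derivWithin hun).1 hY
    set Y' := derivWithin Y (Icc 0 (2 * Real.pi))
    have hYd : ∀ x ∈ Ioo 0 (2 * Real.pi), HasDerivAt Y (Y' x) x := fun x hx =>
      ((hd x (Ioo_subset_Icc_self hx)).hasDerivWithinAt).hasDerivAt (Icc_mem_nhds hx.1 hx.2)
    have hint : ∀ x ∈ Icc 0 (2 * Real.pi), IntervalIntegrable Y' volume 0 x := fun x hx =>
      (hY'.continuousOn.mono (by rw [uIcc_of_le hx.1]; exact Icc_subset_Icc_right hx.2)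
        ).intervalIntegrable
    have h1 : EqOn Y' (primitive^[p + 1] ζ) (Icc 0 (2 * Real.pi)) := by
      refine ih Y' hY' (fun k hk => ?_) fun φ hφ => ?_
      · rw [← iteratedDerivWithin_succ']
        exact h0 (k + 1) (by omega)
      · rw [hw φ hφ, iteratedDeriv_succ]
        have hφ' := hφ.iteratedDeriv (p + 1)
        have hparts := intervalIntegral.integral_mul_deriv_eq_deriv_mul_of_hasDerivAt
          (a := 0) (b := 2 * Real.pi) (u := Y) (u' := Y') (v := iteratedDeriv (p + 1) φ)
          (v' := deriv (iteratedDeriv (p + 1) φ)) (by rw [hu]; exact hY.continuousOn)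
          hφ'.continuous.continuousOn
          (by rw [min_eq_left two_pi_nonneg, max_eq_right two_pi_nonneg]; exact hYd)
          (fun x _ => hφ'.hasDerivAt x) (hint _ right_mem_Icc_two_pi)
          (hφ'.deriv.continuous.intervalIntegrable _ _)
        rw [hparts, hφ'.apply_zero, hφ'.apply_two_pi]
        ring
    intro x hx
    have hsub : Icc 0 x ⊆ Icc 0 (2 * Real.pi) := Icc_subset_Icc_right hx.2
    have hY0 : Y 0 = 0 := by simpa using h0 0 (by omega)
    have hftc := intervalIntegral.integral_eq_sub_of_hasDerivAt_of_le hx.1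
      (hY.continuousOn.mono hsub)
      (fun t ht => hYd t ⟨ht.1, ht.2.trans_le hx.2⟩) (hint x hx)
    rw [hY0, sub_zero] at hftc
    rw [Function.iterate_succ_apply', primitive, ← hftc]
    refine intervalIntegral.integral_congr fun t ht => ?_
    rw [uIcc_of_le hx.1] at ht
    exact h1 (hsub ht)

theorem coeFn_iterate_opA_one (k : ℕ) (ζ : L2) :
    ((opA 1)^[k] ζ : L2) =ᵐ[mu] primitive^[k] ζ := by
  induction k with
  | zero => rfl
  | succ k ih =>
    rw [Function.iterate_succ_apply', Function.iterate_succ_apply']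
    filter_upwards [coeFn_opA_one ((opA 1)^[k] ζ), ae_restrict_mem measurableSet_Ioo] with x h1 hx
    rw [h1, primitive, integral_congr_of_ae_mu ih (Ioo_subset_Icc_self hx)]

theorem opA_eq_iterate (p : ℕ) (ζ : L2) : opA (p + 1) ζ = (opA 1)^[p + 1] ζ := by
  induction p generalizing ζ with
  | zero => rfl
  | succ p ih => rw [opA_succ (by omega), ih, Function.iterate_succ_apply _ (p + 1)]

/-- A function of `H_0^p` is recovered from its weak derivative by `A^(p)`. -/
theorem opA_weakDeriv {p : ℕ} (hp : 1 ≤ p) {y : L2} (hy : y ∈ sobolevH0 p) :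
    opA p (weakDeriv p y) = y := by
  obtain ⟨hH, Y, hY, hyY, h0⟩ := hy
  have hex := hH p hp le_rfl
  have hspec : HasWeakDeriv p y (weakDeriv p y) := by
    unfold weakDeriv
    rw [dif_pos hex]
    exact hex.choose_spec
  obtain ⟨q, rfl⟩ : ∃ q, p = q + 1 := ⟨p - 1, by omega⟩
  have heq : EqOn Y (primitive^[q + 1] (weakDeriv (q + 1) y)) (Icc 0 (2 * Real.pi)) := by
    refine eqOn_iterate_primitive q _ Y (by simpa using hY) h0 fun φ hφ => ?_
    have h1 := hspec φ hφ.contDiff hφ.hasCompactSupport hφ.tsupport_subset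
    rw [integral_mu_eq, integral_mu_eq] at h1
    rw [h1]
    congr 1
    refine integral_congr_of_ae_mu ?_ right_mem_Icc_two_pi
    filter_upwards [hyY] with t ht
    rw [ht]
  rw [opA_eq_iterate]
  refine Lp.ext ?_
  filter_upwards [coeFn_iterate_opA_one (q + 1) (weakDeriv (q + 1) y), hyY,
    ae_restrict_mem measurableSet_Ioo] with x h1 h2 hx
  rw [h1, h2, heq (Ioo_subset_Icc_self hx)]

/-! ### The error estimates -/

theorem proj_sub (n : ℕ) (f g : L2) : proj n (f - g) = proj n f - proj n g :=
  map_sub (trigSpace n).starProjection f g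

theorem norm_proj_le_norm (n : ℕ) (f : L2) : ‖proj n f‖ ≤ ‖f‖ :=
  (trigSpace n).norm_starProjection_apply_le f

theorem coe_galerkinOp (p n : ℕ) (x : trigSpace n) :
    (galerkinOp p n x : L2) = proj n (opA p x) := by
  have h : (projX n x : L2) = x := proj_eq_self x.2
  change proj n (opA p (projX n x : L2)) = _
  rw [h]

theorem constC_nonneg (p : ℕ) : 0 ≤ constC p := by
  unfold constC
  split <;> positivity

/-- On X_n the tail term of the stability estimate is zero, so a vanishing image forces a vanishing
argument. -/
theorem galerkinOp_injective {p n : ℕ} (hp1 : 1 ≤ p) (hp3 : p ≤ 3) (hn : 1 ≤ n) :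
    Function.Injective (galerkinOp p n) := by
  rw [injective_iff_map_eq_zero]
  intro x hx
  have h1 : proj n (opA p x) = 0 := by rw [← coe_galerkinOp, hx]; rfl
  have h2 := norm_proj_le_of_opA hp1 hp3 hn (x : L2)
  rw [h1, proj_eq_self x.2, sub_self, norm_zero, mul_zero, mul_zero, add_zero] at h2
  exact Subtype.ext (norm_le_zero_iff.1 h2)

/-- The scheme solves the Galerkin equation exactly. -/
theorem proj_opA_scheme {p n : ℕ} (hp1 : 1 ≤ p) (hp3 : p ≤ 3) (hn : 1 ≤ n) (f : L2) :
    proj n (opA p (scheme p n f)) = proj n f := by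
  obtain ⟨x, hx⟩ := LinearMap.injective_iff_surjective.1 (galerkinOp_injective hp1 hp3 hn)
    (projX n f)
  have h := (moorePenroseInv_spec (galerkinOp p n) (projX n f)).1 x
  rw [hx, sub_self, norm_zero] at h
  have h1 := sub_eq_zero.1 (norm_le_zero_iff.1 h)
  rw [scheme, ← coe_galerkinOp, h1]
  rfl

theorem scheme_mem (p n : ℕ) (f : L2) : scheme p n f ∈ trigSpace n :=
  (moorePenroseInv (galerkinOp p n) (projX n f)).2

/-- Stability is applied to the error itself. Its tail is that of the exact derivative, counted γ
times through the projection and once more by the triangle inequality. -/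
theorem norm_scheme_sub_weakDeriv_le {p n : ℕ} (hp1 : 1 ≤ p) (hp3 : p ≤ 3) (hn : 1 ≤ n) {δ : ℝ}
    {y yδ : L2} (hy : y ∈ sobolevH0 p) (hδ : ‖yδ - y‖ ≤ δ) :
    ‖scheme p n yδ - weakDeriv p y‖ ≤ constC p * (n : ℝ) ^ p * δ +
      (constGamma p + 1) * ‖weakDeriv p y - proj n (weakDeriv p y)‖ := by
  set u := weakDeriv p y with hu
  set a := scheme p n yδ with ha
  have h := norm_proj_le_of_opA hp1 hp3 hn (a - u)
  have e1 : proj n (opA p (a - u)) = proj n (yδ - y) := by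
    rw [map_sub, proj_sub, proj_opA_scheme hp1 hp3 hn, opA_weakDeriv hp1 hy, proj_sub]
  have e2 : a - u - proj n (a - u) = -(u - proj n u) := by
    rw [proj_sub, proj_eq_self (scheme_mem p n yδ)]
    abel
  rw [e1, e2, norm_neg] at h
  have h1 : ‖a - u‖ ≤ ‖proj n (a - u)‖ + ‖u - proj n u‖ := by
    have := norm_add_le (proj n (a - u)) (a - u - proj n (a - u))
    rwa [add_sub_cancel, e2, norm_neg] at this
  have h2 : constC p * (n : ℝ) ^ p * ‖proj n (yδ - y)‖ ≤ constC p * (n : ℝ) ^ p * δ :=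
    mul_le_mul_of_nonneg_left ((norm_proj_le_norm n _).trans hδ)
      (mul_nonneg (constC_nonneg p) (by positivity))
  linarith

/-! ### Approximation in periodic Sobolev spaces and the convergence rate -/

theorem perTerm_eq (s : ℝ) (f : L2) (k : ℕ) :
    perTerm s f k = (1 + (k : ℝ) ^ 2) ^ s *
      ((inner ℝ f (cosL2 k) ^ 2 + inner ℝ f (sinL2 k) ^ 2) / Real.pi) := by
  have h : (1 / Real.sqrt Real.pi) ^ 2 = 1 / Real.pi := by
    rw [div_pow, Real.sq_sqrt Real.pi_pos.le, one_pow]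
  rw [perTerm, fourierCos, fourierSin, integral_mu_eq, integral_mu_eq, ← inner_cosL2,
    ← inner_sinL2, mul_pow, mul_pow, h]
  ring

theorem perTerm_nonneg (s : ℝ) (f : L2) (k : ℕ) : 0 ≤ perTerm s f k := by
  unfold perTerm
  positivity

theorem norm_sub_proj_le_perNorm {l : ℝ} (hl : 0 < l) {n : ℕ} (hn : 1 ≤ n) {f : L2}
    (hf : f ∈ perSobolev l) : ‖f - proj n f‖ ≤ 1 / (n : ℝ) ^ l * perNorm l f := by
  have hn0 : (0 : ℝ) < n := by exact_mod_cast hn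
  have hnl : 0 < (n : ℝ) ^ l := Real.rpow_pos_of_pos hn0 l
  have hs : Summable fun k : ℕ => perTerm l f (k + 1) := hf
  rw [one_div, inv_mul_eq_div, le_div_iff₀ hnl, mul_comm]
  refine Real.le_sqrt_of_sq_le ?_
  have h1 := (hasSum_norm_sub_proj_sq n f).mul_left (((n : ℝ) ^ l) ^ 2)
  have h2 := ((summable_nat_add_iff n).2 hs).hasSum
  have h3 : ((n : ℝ) ^ l) ^ 2 * ‖f - proj n f‖ ^ 2 ≤ ∑' k : ℕ, perTerm l f (k + n + 1) := by
    refine hasSum_le (fun k => ?_) h1 h2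
    rw [perTerm_eq, add_comm k n]
    have hpi := Real.pi_pos
    refine mul_le_mul_of_nonneg_right ?_ (by positivity)
    -- Rewrites (n^l)² as (n²)^l, to be compared with (1 + (n+k+1)²)^l.
    rw [← Real.rpow_mul_natCast hn0.le, mul_comm l, Real.rpow_mul hn0.le, Real.rpow_natCast]
    refine Real.rpow_le_rpow (by positivity) ?_ hl.le
    push_cast
    have hk : (0 : ℝ) ≤ k := Nat.cast_nonneg k
    nlinarith
  have h4 := hs.sum_add_tsum_nat_add n
  have h5 : 0 ≤ ∑ k ∈ Finset.range n, perTerm l f (k + 1) :=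
    Finset.sum_nonneg fun k _ => perTerm_nonneg _ _ _
  rw [mul_pow]
  have h6 := sq_nonneg (fourierZero f)
  linarith

theorem constGamma_nonneg {p : ℕ} (h1 : 1 ≤ p) (h3 : p ≤ 3) : 0 ≤ constGamma p := by
  unfold constGamma constKappa
  interval_cases p <;> exact add_nonneg zero_le_one (Real.sqrt_nonneg _)

theorem norm_scheme_sub_weakDeriv_le_perNorm {p n : ℕ} (hp1 : 1 ≤ p) (hp3 : p ≤ 3) (hn : 1 ≤ n)
    {l : ℝ} (hl : 0 < l) {δ : ℝ} {y yδ : L2} (hy : y ∈ sobolevH0 p)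
    (hper : weakDeriv p y ∈ perSobolev l) (hδ : ‖yδ - y‖ ≤ δ) :
    ‖scheme p n yδ - weakDeriv p y‖ ≤ constC p * (n : ℝ) ^ p * δ +
      (constGamma p + 1) * (1 / (n : ℝ) ^ l) * perNorm l (weakDeriv p y) := by
  refine (norm_scheme_sub_weakDeriv_le hp1 hp3 hn hy hδ).trans ?_
  rw [mul_assoc (constGamma p + 1)]
  have := constGamma_nonneg hp1 hp3
  gcongr
  exact norm_sub_proj_le_perNorm hl hn hper

theorem norm_scheme_sub_weakDeriv_le_rate {p : ℕ} (hp1 : 1 ≤ p) (hp3 : p ≤ 3) {μ c : ℝ}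
    (hμ : 0 < μ) (hc : 0 < c) {y yδ : L2} (hy : y ∈ sobolevH0 p)
    (hper : weakDeriv p y ∈ perSobolev (2 * μ * p)) {δ : ℝ} (hδ0 : 0 < δ) (hδ1 : δ ≤ 1)
    (hδ : ‖yδ - y‖ ≤ δ) :
    ‖scheme p ⌈c * δ ^ (-(1 / ((2 * μ + 1) * p)))⌉₊ yδ - weakDeriv p y‖ ≤
      (constC p * (c + 1) ^ p + (constGamma p + 1) * (1 / c ^ (2 * μ * p))) *
        (1 + perNorm (2 * μ * p) (weakDeriv p y)) * δ ^ (2 * μ / (2 * μ + 1)) := by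
  have hp0 : (0 : ℝ) < p := by exact_mod_cast hp1
  have hG := constGamma_nonneg hp1 hp3
  have hC := constC_nonneg p
  set θ : ℝ := 1 / ((2 * μ + 1) * p) with hθ
  have hθ0 : 0 < θ := by positivity
  set l : ℝ := 2 * μ * p with hl
  have hl0 : 0 < l := by positivity
  set r : ℝ := δ ^ (-θ) with hr
  have hr1 : 1 ≤ r := Real.one_le_rpow_of_pos_of_le_one_of_nonpos hδ0 hδ1 (by linarith)
  have hr0 : 0 < r := by linarith
  set n := ⌈c * r⌉₊ with hn
  have hn1 : 1 ≤ n := Nat.one_le_iff_ne_zero.2 (Nat.ceil_pos.2 (by positivity)).ne'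
  have hlow : c * r ≤ n := Nat.le_ceil _
  -- The rounding error 1 is absorbed by r ≥ 1, which is where δ ≤ 1 enters.
  have hupp : (n : ℝ) ≤ (c + 1) * r := by
    have := (Nat.ceil_lt_add_one (by positivity : 0 ≤ c * r)).le
    linarith
  set N := perNorm l (weakDeriv p y)
  have hN : 0 ≤ N := Real.sqrt_nonneg _
  -- The exponent θ equalises the noise term r^p δ and the approximation term r^(-l).
  have e1 : r ^ p * δ = δ ^ (2 * μ / (2 * μ + 1)) := by
    rw [hr, ← Real.rpow_mul_natCast hδ0.le]
    nth_rewrite 2 [← Real.rpow_one δ]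
    rw [← Real.rpow_add hδ0, hθ]
    congr 1
    field_simp
    ring
  have e2 : 1 / r ^ l = δ ^ (2 * μ / (2 * μ + 1)) := by
    rw [hr, ← Real.rpow_mul hδ0.le, one_div, ← Real.rpow_neg hδ0.le, hθ, hl]
    congr 1
    field_simp
  have b1 : (n : ℝ) ^ p * δ ≤ (c + 1) ^ p * δ ^ (2 * μ / (2 * μ + 1)) := by
    rw [← e1, ← mul_assoc, ← mul_pow]
    gcongr
  have b2 : 1 / (n : ℝ) ^ l ≤ 1 / c ^ l * δ ^ (2 * μ / (2 * μ + 1)) := by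
    have hcr : (c * r) ^ l ≤ (n : ℝ) ^ l := Real.rpow_le_rpow (by positivity) hlow hl0.le
    have hcr0 : 0 < (c * r) ^ l := Real.rpow_pos_of_pos (by positivity) l
    refine (one_div_le_one_div_of_le hcr0 hcr).trans (le_of_eq ?_)
    rw [← e2, Real.mul_rpow hc.le hr0.le, one_div_mul_one_div]
  set ρ := δ ^ (2 * μ / (2 * μ + 1))
  have hρ : 0 ≤ ρ := Real.rpow_nonneg hδ0.le _
  refine (norm_scheme_sub_weakDeriv_le_perNorm hp1 hp3 hn1 hl0 hy hper hδ).trans ?_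
  calc constC p * (n : ℝ) ^ p * δ + (constGamma p + 1) * (1 / (n : ℝ) ^ l) * N
      = constC p * ((n : ℝ) ^ p * δ) + (constGamma p + 1) * (1 / (n : ℝ) ^ l) * N := by ring
    _ ≤ constC p * ((c + 1) ^ p * ρ) + (constGamma p + 1) * (1 / c ^ l * ρ) * N := by gcongr
    _ ≤ constC p * ((c + 1) ^ p * ρ) * (1 + N) +
        (constGamma p + 1) * (1 / c ^ l * ρ) * (1 + N) := by
        refine add_le_add (le_mul_of_one_le_right (by positivity) (by linarith)) ?_
        exact mul_le_mul_of_nonneg_left (by linarith) (by positivity)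
    _ = _ := by ring

end

end NumDiff

theorem theorem6p1 (p : ℕ) (hp1 : 1 ≤ p) (hp3 : p ≤ 3) :
    -- the general error estimate
    (∀ (n : ℕ) (_ : 1 ≤ n) (δ : ℝ) (y yδ : NumDiff.L2),
      y ∈ NumDiff.sobolevH0 p → ‖yδ - y‖ ≤ δ →
        ‖NumDiff.scheme p n yδ - NumDiff.weakDeriv p y‖ ≤
          NumDiff.constC p * (n : ℝ) ^ p * δ +
            (NumDiff.constGamma p + 1) *
              ‖NumDiff.weakDeriv p y - (NumDiff.projX n (NumDiff.weakDeriv p y) : NumDiff.L2)‖) ∧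
    -- the error estimate under periodic smoothness
    (∀ (l : ℝ) (_ : 0 < l) (n : ℕ) (_ : 1 ≤ n) (δ : ℝ) (y yδ : NumDiff.L2),
      y ∈ NumDiff.sobolevH0 p → NumDiff.weakDeriv p y ∈ NumDiff.perSobolev l → ‖yδ - y‖ ≤ δ →
        ‖NumDiff.scheme p n yδ - NumDiff.weakDeriv p y‖ ≤
          NumDiff.constC p * (n : ℝ) ^ p * δ +
            (NumDiff.constGamma p + 1) * (1 / (n : ℝ) ^ l) *
              NumDiff.perNorm l (NumDiff.weakDeriv p y)) ∧
    -- the convergence rate for the parameter choice `n(δ) = ⌈c δ^(-1/((2μ+1)p))⌉`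
    (∀ (μ : ℝ) (_ : 0 < μ) (c : ℝ) (_ : 0 < c), ∃ K : ℝ, ∀ y : NumDiff.L2,
      y ∈ NumDiff.sobolevH0 p → NumDiff.weakDeriv p y ∈ NumDiff.perSobolev (2 * μ * p) →
        ∀ (δ : ℝ) (_ : 0 < δ) (_ : δ ≤ 1) (yδ : NumDiff.L2), ‖yδ - y‖ ≤ δ →
          ‖NumDiff.scheme p ⌈c * δ ^ (-(1 / ((2 * μ + 1) * p)))⌉₊ yδ - NumDiff.weakDeriv p y‖ ≤
            K * (1 + NumDiff.perNorm (2 * μ * p) (NumDiff.weakDeriv p y)) *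
              δ ^ (2 * μ / (2 * μ + 1))) := by
  refine ⟨fun n hn δ y yδ hy hδ => NumDiff.norm_scheme_sub_weakDeriv_le hp1 hp3 hn hy hδ,
    fun l hl n hn δ y yδ hy hper hδ =>
      NumDiff.norm_scheme_sub_weakDeriv_le_perNorm hp1 hp3 hn hl hy hper hδ,
    -- K is read off from the rate estimate: it involves only p, μ and c.
    fun μ hμ c hc => ⟨_, fun y hy hper δ hδ0 hδ1 yδ hδ =>
      NumDiff.norm_scheme_sub_weakDeriv_le_rate hp1 hp3 hμ hc hy hper hδ0 hδ1 hδ⟩⟩
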